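/- **Setting.** Let $\Sigma$ be a smooth surface, possibly non-orientable and possibly with boundary. A *generic curve* is a smooth immersion of the oriented circle into the interior of $\Sigma$ whose only multiple points are finitely many transverse double points. An (oriented knot) *diagram* $D$ is a generic curve with over/under information at each double point (crossing); $\#D$ is the set of its crossings. $D$ is *pseudo-classical* if the underlying closed curve is an orientation-preserving path in $\Sigma$. In that case the $2$-cabling of $D$ has two components, and a *labeling* of $D$ is a choice of which of them is called right ($D_R$) and which is called left ($D_L$); equivalently it is a continuous choice of a side of the curve. At a crossing $x$ the $2$-cabling has four crossings; the *input crossing* is the one at which the components of the cabling enter this pattern. Put $\operatorname{sign}(x)=1,-1,i,-i$ if in the input crossing, respectively, $D_R$ goes over $D_L$, $D_L$ goes over $D_R$, $D_R$ goes over itself, $D_L$ goes over itself. Put $\operatorname{sign}^f_1(x)=\operatorname{sign}(x)$ if $\operatorname{sign}(x)=\pm i$, and $\operatorname{sign}^f_1(x)=1$ if $\operatorname{sign}(x)=\pm1$. The loop $l_1(x)$ leaves $x$ along the upper outgoing arc and follows $D$ until its return to $x$ along the lower incoming arc; $l_2(x)$ is the complementary loop. Let $\mathcal R=\mathbb Z[i]$,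 and let $N\subset\mathcal R$ be an additive subgroup stable under complex conjugation. Let $\bar{\mathcal A}_2(N)$ be the degree $2$ part of the commutative polynomial algebra generated by the free homotopy classes of oriented closed non-contractible curves on $\Sigma$, with coefficients in the additive group $\mathcal R/N$; that is, $\bar{\mathcal A}_2(N)$ consists of the finite formal sums, with coefficients in $\mathcal R/N$, of symmetric products $c_1\otimes c_2=c_2\otimes c_1$ of such classes. A product in which one of the classes is contractible is $0$. For a pseudo-classical diagram $D$ with a labeling set $$\bar\Delta_N(D)=\sum_{x\in\#D}\operatorname{sign}^f_1(x)\,[l_1(x)]\otimes[l_2(x)]\in\bar{\mathcal A}_2(N).$$ **Theorem.** Let $D_1$ and $D_2$ be pseudo-classical diagrams on $\Sigma$ such that the curve underlying $D_1$ can be transformed into the one underlying $D_2$ by a finite sequence of flat Reidemeister moves $R_1,R_2,R_3$ (i.e. Reidemeister moves without over/under information, and their inverses) and ambient isotopies. Then $D_1$ and $D_2$ have labelings, and for every labeling of $D_1$ and every labeling of $D_2$ the elements $\bar\Delta_N(D_1)$ and $\bar\Delta_N(D_2)$ coincide up to simultaneous complex conjugation of all the coefficients, both for $N=\mathcal R_2=\{2a+bi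 : a,b\in\mathbb Z\}$ and for the smaller subgroup $N=2\mathbb Z=\{2a : a\in\mathbb Z\}$. -/

import Mathlib

open scoped Manifold ContDiff

noncomputable section

namespace FlatTuraev

/-! ## Coefficients

`ℛ = ℤ[i]` is Mathlib's `GaussianInt`. -/

/-- The additive subgroup `ℛ₂ = {2a + bi : a, b ∈ ℤ}` of `ℛ = ℤ[i]`.
(It is not closed under multiplication, since `i * i = -1`, so `ℛ ⧸ ℛ₂` is a quotient of
additive groups.) -/
def R₂ : AddSubgroup GaussianInt where
  carrier := {z | Even z.re}
  zero_mem' := by simp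
  add_mem' := by
    intro a b ha hb
    simpa using ha.add hb
  neg_mem' := by
    intro a ha
    simpa using ha

/-- The additive subgroup `2ℤ = {2a : a ∈ ℤ}` of `ℛ = ℤ[i]`: modulo it real parts are reduced
mod `2` and imaginary parts are kept. -/
def twoZ : AddSubgroup GaussianInt where
  carrier := {z | Even z.re ∧ z.im = 0}
  zero_mem' := by simp
  add_mem' := by
    rintro a b ⟨ha, ha'⟩ ⟨hb, hb'⟩
    exact ⟨by simpa using ha.add hb, by simp [ha', hb']⟩
  neg_mem' := by
    rintro a ⟨ha, ha'⟩
    exact ⟨by simpa using ha, by simp [ha']⟩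

/-- Complex conjugation on `ℛ`, as an additive map. -/
def conjR : GaussianInt →+ GaussianInt := (starRingEnd GaussianInt).toAddMonoidHom

theorem R₂_conj : R₂ ≤ R₂.comap conjR := fun _ hz => hz

theorem twoZ_conj : twoZ ≤ twoZ.comap conjR := by
  rintro z ⟨h, h'⟩
  exact ⟨h, neg_eq_zero.mpr h'⟩

/-! ## Free homotopy classes of closed curves, and the target of the invariant -/

section Loops

variable (S : Type*) [TopologicalSpace S]

/-- Free homotopy of closed curves. -/
def freeHomotopy : Setoid C(AddCircle (1 : ℝ), S) :=
  ⟨ContinuousMap.Homotopic, ContinuousMap.Homotopic.equivalence⟩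

/-- Free homotopy classes of oriented closed curves in `S`. -/
def LoopClass : Type _ := Quotient (freeHomotopy S)

variable {S}

/-- The class of a closed curve. -/
def loopClass (l : C(AddCircle (1 : ℝ), S)) : LoopClass S := Quotient.mk (freeHomotopy S) l

/-- The class of contractible curves. -/
def LoopClass.Contractible (c : LoopClass S) : Prop :=
  ∃ x : S, c = loopClass (ContinuousMap.const _ x)

variable (S) in
/-- The generators: homotopy classes of oriented closed non-contractible curves. -/
def Generator : Type _ := {c : LoopClass S // ¬ c.Contractible}

variable (S) in
/-- The homogeneous degree `2` component of the commutative (symmetric) polynomial algebra on the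
generators, with coefficients in `ℛ ⧸ N`: it is free over `ℛ ⧸ N` on the monomials
`c₁ ⊗ c₂ = c₂ ⊗ c₁`, i.e. on unordered pairs of generators. -/
abbrev SymTensor (N : AddSubgroup GaussianInt) : Type _ :=
  Sym2 (Generator S) →₀ (GaussianInt ⧸ N)

open Classical in
/-- The element `z c₁ ⊗ c₂`, where contractible classes are zero. -/
def monomial (N : AddSubgroup GaussianInt) (z : GaussianInt) (c₁ c₂ : LoopClass S) :
    SymTensor S N :=
  if h : ¬ c₁.Contractible ∧ ¬ c₂.Contractible then
    Finsupp.single s(⟨c₁, h.1⟩, ⟨c₂, h.2⟩) (z : GaussianInt ⧸ N)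
  else 0

/-- Simultaneous complex conjugation of all coefficients. -/
def conjCoeff (N : AddSubgroup GaussianInt) (hN : N ≤ N.comap conjR) (a : SymTensor S N) :
    SymTensor S N :=
  a.mapRange (QuotientAddGroup.map N N conjR hN) (map_zero _)

/-- `a` and `b` coincide up to simultaneous complex conjugation of all coefficients. -/
def EqUpToConj (N : AddSubgroup GaussianInt) (hN : N ≤ N.comap conjR) (a b : SymTensor S N) :
    Prop :=
  a = b ∨ a = conjCoeff N hN b

/-- The closed curve obtained by running along `γ` from parameter `a` to parameter `b`, where
`γ a = γ b`. -/
def subloop (γ : ℝ → S) (hγ : Continuous γ) (a b : ℝ) (h : γ a = γ b) :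
    C(AddCircle (1 : ℝ), S) where
  toFun := AddCircle.liftIco 1 0 (fun x => γ (a + (b - a) * x))
  continuous_toFun := AddCircle.liftIco_zero_continuous (by simpa using h)
    (hγ.comp (by fun_prop)).continuousOn

end Loops

/-! ## Generic curves and diagrams -/

section Surface

/- `S` is a smooth surface, with possibly empty boundary. -/
variable {S : Type*} [TopologicalSpace S] [ChartedSpace (EuclideanHalfSpace 2) S]

/-- The double points of a `1`-periodic curve, each given by its two parameters `s < t` in
`[0, 1)`. -/
def crossings (γ : ℝ → S) : Set (ℝ × ℝ) :=
  {p | 0 ≤ p.1 ∧ p.1 < p.2 ∧ p.2 < 1 ∧ γ p.1 = γ p.2}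

/-- The velocity vector `γ'(t) ∈ T_{γ(t)} S`. (All tangent spaces at points of `S` have the same
underlying vector space, and if `γ s = γ t` then `γ'(s)` and `γ'(t)` are vectors in the same
tangent space.) -/
def velocity (γ : ℝ → S) (t : ℝ) : EuclideanSpace ℝ (Fin 2) :=
  mfderiv 𝓘(ℝ, ℝ) (𝓡∂ 2) γ t (1 : ℝ)

variable (S) in
/-- A generic oriented closed curve in the interior of `S`: a smooth immersion of the oriented
circle `ℝ / ℤ`, given as a `1`-periodic map, whose only multiple points are finitely many
transverse double points. -/
structure GenericCurve where
  toFun : ℝ → S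
  smooth : ContMDiff 𝓘(ℝ, ℝ) (𝓡∂ 2) ∞ toFun
  periodic : ∀ t, toFun (t + 1) = toFun t
  interior : ∀ t, toFun t ∈ (𝓡∂ 2).interior S
  immersion : ∀ t, velocity toFun t ≠ 0
  finite_crossings : (crossings toFun).Finite
  double : ∀ r ∈ Set.Ico (0 : ℝ) 1, ∀ s ∈ Set.Ico (0 : ℝ) 1, ∀ t ∈ Set.Ico (0 : ℝ) 1,
    toFun r = toFun s → toFun s = toFun t → r = s ∨ s = t ∨ r = t
  transverse : ∀ p ∈ crossings toFun,
    LinearIndependent ℝ ![velocity toFun p.1, velocity toFun p.2]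

variable (S) in
/-- An oriented knot diagram: a generic curve with over/under information at each crossing;
`firstOver x` says that the branch through the smaller parameter is the upper one. -/
structure Diagram extends GenericCurve S where
  firstOver : crossings toFun → Bool

/-- A continuous vector field of `S` along the closed curve `γ`. -/
structure FieldAlong [IsManifold (𝓡∂ 2) ∞ S] (γ : ℝ → S) where
  vec : ℝ → EuclideanSpace ℝ (Fin 2)
  periodic : ∀ t, vec (t + 1) = vec t
  continuous : Continuous fun t => (⟨γ t, vec t⟩ : TangentBundle (𝓡∂ 2) S)

/-- The closed curve `C` is an orientation-preserving path: the pull-back of the tangent bundle of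
`S` to the circle along `C` is orientable (equivalently, for a bundle over a circle, it has a
continuous global frame). -/
def GenericCurve.PseudoClassical [IsManifold (𝓡∂ 2) ∞ S] (C : GenericCurve S) : Prop :=
  ∃ E F : FieldAlong C.toFun, ∀ t, LinearIndependent ℝ ![E.vec t, F.vec t]

/-- A labeling of `C`, i.e. a choice of which of the two components of the `2`-cabling of `C`
is called the right one. It is given by a continuous vector field along `C` that is nowhere tangent
to `C`: the right component is `C` pushed slightly in the direction of the field, the left one is
`C` pushed slightly in the opposite direction. -/
structure Labeling [IsManifold (𝓡∂ 2) ∞ S] (C : GenericCurve S) extends FieldAlong C.toFun where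
  transverse : ∀ t, LinearIndependent ℝ ![velocity C.toFun t, vec t]

variable [IsManifold (𝓡∂ 2) ∞ S]

/-- For a crossing with parameters `a, b`: the parallel copy of the branch through `a` that passes
through the input crossing of the `4`-crossing pattern belongs to the right component. The input
crossing is the one where both parallel copies enter the pattern, so the copy of the branch `a`
passing through it is the one shifted backwards along the branch `b`; it is the right one iff the
field at `a` points to the side of `-γ'(b)`. -/
def Labeling.RightAtInput {C : GenericCurve S} (L : Labeling C) (a b : ℝ) : Prop :=
  ∃ p q : ℝ, 0 < q ∧ L.vec a = p • velocity C.toFun a - q • velocity C.toFun b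

namespace Diagram

variable (D : Diagram S)

/-- Parameter of the upper branch at a crossing. -/
def upper (x : crossings D.toFun) : ℝ := if D.firstOver x then x.1.1 else x.1.2

/-- Parameter of the lower branch at a crossing. -/
def lower (x : crossings D.toFun) : ℝ := if D.firstOver x then x.1.2 else x.1.1

open Classical in
/-- The sign of a crossing of a labeled diagram. -/
def sign (L : Labeling D.toGenericCurve) (x : crossings D.toFun) : GaussianInt :=
  if L.RightAtInput (D.upper x) (D.lower x) then
    -- the right component is the upper one in the input crossing
    if L.RightAtInput (D.lower x) (D.upper x) then ⟨0, 1⟩ else 1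
  else
    if L.RightAtInput (D.lower x) (D.upper x) then -1 else ⟨0, -1⟩

open Classical in
/-- The sign of a crossing considered as a flat self-intersection point: it is `sign x` if
`sign x = ±i`, and `1` if `sign x = ±1`. -/
def flatSign (L : Labeling D.toGenericCurve) (x : crossings D.toFun) : GaussianInt :=
  if D.sign L x = ⟨0, 1⟩ ∨ D.sign L x = ⟨0, -1⟩ then D.sign L x else 1

/-- The part of the diagram from the crossing `x` along the first outgoing arc (the one with the
smaller parameter) back to `x`. -/
def loopFirst (x : crossings D.toFun) : C(AddCircle (1 : ℝ), S) :=
  subloop D.toFun D.smooth.continuous x.1.1 x.1.2 x.2.2.2.2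

/-- The complementary part of the diagram, through the base point of the circle. -/
def loopSecond (x : crossings D.toFun) : C(AddCircle (1 : ℝ), S) :=
  subloop D.toFun D.smooth.continuous x.1.2 (x.1.1 + 1) (by rw [D.periodic, x.2.2.2.2])

/-- `l₁(x)` leaves `x` along the upper outgoing arc and returns along the lower incoming one. -/
def l₁ (x : crossings D.toFun) : C(AddCircle (1 : ℝ), S) :=
  if D.firstOver x then D.loopFirst x else D.loopSecond x

/-- `l₂(x)` leaves `x` along the lower outgoing arc and returns along the upper incoming one. -/
def l₂ (x : crossings D.toFun) : C(AddCircle (1 : ℝ), S) :=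
  if D.firstOver x then D.loopSecond x else D.loopFirst x

/-- `Δ̄(D)`, the sum over all (finitely many) crossings `x` of `flatSign x [l₁ x] ⊗ [l₂ x]`, with
coefficients in `ℛ ⧸ N`. -/
def deltaBar (N : AddSubgroup GaussianInt) (L : Labeling D.toGenericCurve) : SymTensor S N :=
  ∑ᶠ x : crossings D.toFun,
    monomial N (D.flatSign L x) (loopClass (D.l₁ x)) (loopClass (D.l₂ x))

end Diagram

/-! ## Flat Reidemeister moves -/

/-- The closed square `[-1, 1]²`; a Reidemeister move happens in its image under an embedding of
the plane. -/
def closedBox : Set (ℝ × ℝ) := Set.Icc (-1) 1 ×ˢ Set.Icc (-1) 1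

/-- The open square `(-1, 1)²`. -/
def openBox : Set (ℝ × ℝ) := Set.Ioo (-1) 1 ×ˢ Set.Ioo (-1) 1

/-- `ψ` is a smooth open embedding of the plane into `S`. -/
def IsPlaneEmbedding (ψ : ℝ × ℝ → S) : Prop :=
  Function.Injective ψ ∧ IsLocalDiffeomorph 𝓘(ℝ, ℝ × ℝ) (𝓡∂ 2) ∞ ψ

/-- Outside the parameter set `A ⊆ (0, 1)` (modulo `1`) the curves `C`, `C'` coincide and stay
outside the image of the closed square. -/
def AgreeOutside (ψ : ℝ × ℝ → S) (A : Set ℝ) (C C' : GenericCurve S) : Prop :=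
  A ⊆ Set.Ioo 0 1 ∧
    ∀ t ∈ Set.Ico (0 : ℝ) 1, t ∉ A → C.toFun t = C'.toFun t ∧ C.toFun t ∉ ψ '' closedBox

/-- `C'` is obtained from `C` by an ambient isotopy of `S` followed by an orientation-preserving
reparametrization of the circle. -/
def IsotopyMove (C C' : GenericCurve S) : Prop :=
  ∃ (H : ℝ → (S ≃ₘ^∞⟮𝓡∂ 2, 𝓡∂ 2⟯ S)) (θ : ℝ → ℝ),
    ContMDiff (𝓘(ℝ, ℝ).prod (𝓡∂ 2)) (𝓡∂ 2) ∞ (fun p : ℝ × S => H p.1 p.2) ∧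
    (∀ x, H 0 x = x) ∧
    ContDiff ℝ ∞ θ ∧ (∀ t, θ (t + 1) = θ t + 1) ∧ (∀ t, 0 < deriv θ t) ∧
    ∀ t, C'.toFun t = H 1 (C.toFun (θ t))

/-- Flat first Reidemeister move (removing a kink): within a disc, an arc of `C` with exactly one
self-crossing is replaced by an embedded arc. -/
def MoveR1 (C C' : GenericCurve S) : Prop :=
  ∃ (ψ : ℝ × ℝ → S) (a b : ℝ), IsPlaneEmbedding ψ ∧ a < b ∧
    AgreeOutside ψ (Set.Icc a b) C C' ∧
    (∀ t ∈ Set.Ioo a b, C.toFun t ∈ ψ '' openBox ∧ C'.toFun t ∈ ψ '' openBox) ∧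
    Set.InjOn C'.toFun (Set.Icc a b) ∧
    ∃ s₀ t₀ : ℝ, a < s₀ ∧ s₀ < t₀ ∧ t₀ < b ∧ C.toFun s₀ = C.toFun t₀ ∧
      ∀ s ∈ Set.Icc a b, ∀ t ∈ Set.Icc a b, s < t → C.toFun s = C.toFun t → s = s₀ ∧ t = t₀

/-- Within the square, `C` and `C'` consist of `n` strands, the `k`-th being the graph of `f k`
for `C` and of `g k` for `C'`, both run through at the parameters `c k + w k * x`, `-1 ≤ x ≤ 1`
(from left to right if `0 < w k`, from right to left if `w k < 0`); elsewhere `C` and `C'`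
coincide and avoid the square. -/
def InStrandForm (n : ℕ) (f g : Fin n → ℝ → ℝ) (C C' : GenericCurve S) : Prop :=
  ∃ (ψ : ℝ × ℝ → S) (c w : Fin n → ℝ), IsPlaneEmbedding ψ ∧
    (∀ k, w k ≠ 0) ∧
    (∀ j k, j ≠ k → ∀ x ∈ Set.Icc (-1 : ℝ) 1, ∀ y ∈ Set.Icc (-1 : ℝ) 1,
      c j + w j * x ≠ c k + w k * y) ∧
    AgreeOutside ψ {t | ∃ k, ∃ x ∈ Set.Icc (-1 : ℝ) 1, t = c k + w k * x} C C' ∧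
    ∀ k, ∀ x ∈ Set.Icc (-1 : ℝ) 1,
      f k x ∈ Set.Ioo (-1 : ℝ) 1 ∧ g k x ∈ Set.Ioo (-1 : ℝ) 1 ∧
      C.toFun (c k + w k * x) = ψ (x, f k x) ∧ C'.toFun (c k + w k * x) = ψ (x, g k x)

/-- Flat second Reidemeister move (removing a bigon): in `C` the strand `0` starts below the strand
`1`, rises above it at `x₁` and comes back below it at `x₂`; in `C'` it stays below. -/
def MoveR2 (C C' : GenericCurve S) : Prop :=
  ∃ f g : Fin 2 → ℝ → ℝ, InStrandForm 2 f g C C' ∧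
    (∀ x ∈ Set.Icc (-1 : ℝ) 1, g 0 x < g 1 x) ∧
    ∃ x₁ x₂ : ℝ, -1 < x₁ ∧ x₁ < x₂ ∧ x₂ < 1 ∧
      (∀ x ∈ Set.Ico (-1) x₁, f 0 x < f 1 x) ∧
      (∀ x ∈ Set.Ioo x₁ x₂, f 1 x < f 0 x) ∧
      (∀ x ∈ Set.Ioc x₂ 1, f 0 x < f 1 x)

/-- In the strip over `[-1, 1]` the graph of `u` passes from below to above the graph of `v`,
crossing it exactly at the abscissa `z ∈ (-1, 1)`. -/
def CrossesUpAt (u v : ℝ → ℝ) (z : ℝ) : Prop :=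
  z ∈ Set.Ioo (-1 : ℝ) 1 ∧ (∀ x ∈ Set.Ico (-1) z, u x < v x) ∧ (∀ x ∈ Set.Ioc z 1, v x < u x)

/-- Flat third Reidemeister move: three strands cross pairwise exactly once, forming a triangle;
in `C` the crossings come from left to right in the order `01, 02, 12`, in `C'` in the order
`12, 02, 01`, i.e. a strand has been moved across the crossing of the two others. -/
def MoveR3 (C C' : GenericCurve S) : Prop :=
  ∃ f g : Fin 3 → ℝ → ℝ, InStrandForm 3 f g C C' ∧
    (∃ x₀₁ x₀₂ x₁₂ : ℝ, x₀₁ < x₀₂ ∧ x₀₂ < x₁₂ ∧ CrossesUpAt (f 0) (f 1) x₀₁ ∧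
      CrossesUpAt (f 0) (f 2) x₀₂ ∧ CrossesUpAt (f 1) (f 2) x₁₂) ∧
    (∃ y₀₁ y₀₂ y₁₂ : ℝ, y₁₂ < y₀₂ ∧ y₀₂ < y₀₁ ∧ CrossesUpAt (g 0) (g 1) y₀₁ ∧
      CrossesUpAt (g 0) (g 2) y₀₂ ∧ CrossesUpAt (g 1) (g 2) y₁₂)

/-- A single flat move. -/
def FlatMove (C C' : GenericCurve S) : Prop :=
  IsotopyMove C C' ∨ MoveR1 C C' ∨ MoveR2 C C' ∨ MoveR3 C C'

/-- `C` can be transformed into `C'` by a finite sequence of flat Reidemeister moves, their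
inverses, and ambient isotopies. -/
def FlatEquivalent (C C' : GenericCurve S) : Prop := Relation.EqvGen FlatMove C C'

end Surface

end FlatTuraev

end

open scoped Manifold ContDiff

noncomputable section

namespace FlatTuraev

open Set Filter Topology

/-! ### Planar determinants and continuous vector fields along maps. -/

section

/-! A labeling, paired with the velocity, orients the surface along the curve: a sign `o t` relative
to the preferred chart at `γ t`. At a crossing with parameters `s`, `t` both branches lie over the
same point, so `o s` and `o t` can be compared. If they agree, the sign is `±1` and the flat sign is
`1`. If they differ, the flat sign is `i` or `-i` according to the sign of `o s * det(γ' s, γ' t)`,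
which is symmetric in `s` and `t`. Changing over and under therefore only exchanges the two loops,
and the symmetric product ignores this. The invariant is thus a quantity `delta` of the flat curve
and the orientation along it (`Diagram.deltaBar_eq`). As the circle is connected, two orientations
agree everywhere or nowhere, and reversal exchanges `i` and `-i` (`GenericCurve.delta_conj`).

It remains to carry an orientation through each move with `delta` unchanged. An isotopy pushes
everything forward. A Reidemeister move changes the curve only inside a planar chart: crossings
outside keep their signs and loop classes (`DiscMove.sum_outside`), and inside the chart the loops
are compared by a straight-line homotopy. For `R1` one loop of the vanishing crossing is
contractible. For `R2` the two crossings have the same loop classes, and their coefficients are `1,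
1` or `i, -i`, so the sum is `2` or `0`. For `R3` the three crossings match one by one. Hence any
conjugation-stable subgroup containing `2` works.

`DeltaCorrespond` goes in both directions, so it survives inverse moves, and the intermediate curves
receive their orientations by transport. -/

/-- The standard area form on the plane. -/
def det2 (u v : EuclideanSpace ℝ (Fin 2)) : ℝ := u 0 * v 1 - u 1 * v 0

theorem det2_swap (u v : EuclideanSpace ℝ (Fin 2)) : det2 v u = -det2 u v := by
  unfold det2; ring

theorem det2_ne_zero_iff (u v : EuclideanSpace ℝ (Fin 2)) :
    det2 u v ≠ 0 ↔ LinearIndependent ℝ ![u, v] := by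
  have h := Matrix.linearIndependent_rows_iff_isUnit (A := !![u 0, u 1; v 0, v 1])
  rw [Matrix.isUnit_iff_isUnit_det, isUnit_iff_ne_zero, Matrix.det_fin_two_of] at h
  have h' : det2 u v = u 0 * v 1 - u 1 * v 0 := rfl
  rw [h', ← h]
  have e := (WithLp.linearEquiv 2 ℝ (Fin 2 → ℝ)).toLinearMap.linearIndependent_iff
    (v := ![u, v]) (LinearEquiv.ker _)
  rw [← e]
  have : (!![u 0, u 1; v 0, v 1] : Matrix (Fin 2) (Fin 2) ℝ).row =
      (WithLp.linearEquiv 2 ℝ (Fin 2 → ℝ)).toLinearMap ∘ ![u, v] := by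
    funext i j
    fin_cases i <;> fin_cases j <;> rfl
  rw [this]

/-- The determinant of a linear endomorphism of the plane. -/
def jac (A : EuclideanSpace ℝ (Fin 2) →L[ℝ] EuclideanSpace ℝ (Fin 2)) : ℝ :=
  det2 (A (EuclideanSpace.single 0 1)) (A (EuclideanSpace.single 1 1))

theorem det2_map (A : EuclideanSpace ℝ (Fin 2) →L[ℝ] EuclideanSpace ℝ (Fin 2))
    (u v : EuclideanSpace ℝ (Fin 2)) : det2 (A u) (A v) = jac A * det2 u v := by
  have h : ∀ w : EuclideanSpace ℝ (Fin 2),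
      A w = w 0 • A (EuclideanSpace.single 0 1) + w 1 • A (EuclideanSpace.single 1 1) := by
    intro w
    rw [← map_smul, ← map_smul, ← map_add]
    congr 1
    ext i
    fin_cases i <;> simp
  rw [h u, h v]
  simp only [jac, det2, PiLp.add_apply, PiLp.smul_apply, smul_eq_mul]
  ring

theorem jac_mul_of_leftInverse {A B : EuclideanSpace ℝ (Fin 2) →L[ℝ] EuclideanSpace ℝ (Fin 2)}
    (h : ∀ w, B (A w) = w) : jac B * jac A = 1 := by
  have h1 := det2_map B (A (EuclideanSpace.single 0 1)) (A (EuclideanSpace.single 1 1))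
  rw [h, h] at h1
  rw [show jac A = det2 (A (EuclideanSpace.single 0 1)) (A (EuclideanSpace.single 1 1)) from rfl,
    ← h1]
  simp [det2]

/-- By Cramer's rule the second vector is `v` turned by a quarter turn in the coordinates of the
frame `e, f`, so the determinant is the sum of the squared coordinates of `v` times `det2 e f`. -/
theorem det2_rotated_ne_zero {v e f : EuclideanSpace ℝ (Fin 2)} (hv : v ≠ 0)
    (h : det2 e f ≠ 0) :
    det2 v ((-(det2 e v / det2 e f)) • e + (det2 v f / det2 e f) • f) ≠ 0 := by
  have key : det2 v ((-(det2 e v / det2 e f)) • e + (det2 v f / det2 e f) • f) =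
      (det2 e v ^ 2 + det2 v f ^ 2) / det2 e f := by
    have h2 : det2 v ((-(det2 e v / det2 e f)) • e + (det2 v f / det2 e f) • f) =
        -(det2 e v / det2 e f) * det2 v e + (det2 v f / det2 e f) * det2 v f := by
      generalize det2 e v / det2 e f = a
      generalize det2 v f / det2 e f = b
      simp only [det2, PiLp.add_apply, PiLp.smul_apply, smul_eq_mul]
      ring
    rw [h2, det2_swap e v]
    ring
  rw [key]
  refine div_ne_zero (fun h0 => hv ?_) h
  have ha : det2 e v = 0 := by nlinarith [sq_nonneg (det2 e v), sq_nonneg (det2 v f)]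
  have hb : det2 v f = 0 := by nlinarith [sq_nonneg (det2 e v), sq_nonneg (det2 v f)]
  have e0 : det2 e f * v 0 = 0 := by
    have : det2 e f * v 0 = det2 v f * e 0 + det2 e v * f 0 := by unfold det2; ring
    rw [this, ha, hb]; ring
  have e1 : det2 e f * v 1 = 0 := by
    have : det2 e f * v 1 = det2 v f * e 1 + det2 e v * f 1 := by unfold det2; ring
    rw [this, ha, hb]; ring
  ext i
  fin_cases i
  · simpa using (mul_eq_zero.1 e0).resolve_left h
  · simpa using (mul_eq_zero.1 e1).resolve_left h

theorem continuousAt_det2 {X : Type*} [TopologicalSpace X] {u v : X → EuclideanSpace ℝ (Fin 2)}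
    {x : X} (hu : ContinuousAt u x) (hv : ContinuousAt v x) :
    ContinuousAt (fun y => det2 (u y) (v y)) x := by
  unfold det2
  fun_prop

variable {S : Type*} [TopologicalSpace S] [ChartedSpace (EuclideanHalfSpace 2) S]

theorem velocity_congr {γ γ' : ℝ → S} {t : ℝ} (h : γ =ᶠ[𝓝 t] γ') :
    velocity γ t = velocity γ' t := by
  unfold velocity
  rw [h.mfderiv_eq]
  rfl

theorem GenericCurve.mdifferentiable (C : GenericCurve S) :
    MDifferentiable 𝓘(ℝ, ℝ) (𝓡∂ 2) C.toFun := C.smooth.mdifferentiable (by simp)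

theorem velocity_comp {γ : ℝ → S} (hγ : MDifferentiable 𝓘(ℝ, ℝ) (𝓡∂ 2) γ) {θ : ℝ → ℝ} {t : ℝ}
    (hθ : DifferentiableAt ℝ θ t) :
    velocity (γ ∘ θ) t = deriv θ t • velocity γ (θ t) := by
  have h := mfderiv_comp (I' := 𝓘(ℝ, ℝ)) t (hγ (θ t)) hθ.mdifferentiableAt
  rw [mfderiv_eq_fderiv] at h
  have h1 : velocity (γ ∘ θ) t =
      (mfderiv 𝓘(ℝ, ℝ) (𝓡∂ 2) γ (θ t) : ℝ →L[ℝ] EuclideanSpace ℝ (Fin 2)) (fderiv ℝ θ t 1) :=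
    congrArg (fun A : ℝ →L[ℝ] EuclideanSpace ℝ (Fin 2) => A 1) h
  have h2 : fderiv ℝ θ t (1 : ℝ) = deriv θ t • (1 : ℝ) := by simp
  rw [h1, h2]
  exact ContinuousLinearMap.map_smul
    (mfderiv 𝓘(ℝ, ℝ) (𝓡∂ 2) γ (θ t) : ℝ →L[ℝ] EuclideanSpace ℝ (Fin 2)) _ _

theorem velocity_periodic (C : GenericCurve S) (t : ℝ) :
    velocity C.toFun (t + 1) = velocity C.toFun t := by
  have h := velocity_comp (S := S) C.mdifferentiable (θ := fun t => t + 1) (t := t) (by fun_prop)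
  have e : C.toFun ∘ (fun t => t + 1) = C.toFun := funext C.periodic
  rw [e] at h
  simpa using h.symm

variable [IsManifold (𝓡∂ 2) ∞ S]

/-- The vectors `u x ∈ T_{g x} S` depend continuously on `x` at `x₀`. -/
def ContAlong {X : Type*} [TopologicalSpace X] (g : X → S) (u : X → EuclideanSpace ℝ (Fin 2))
    (x₀ : X) : Prop :=
  ContinuousAt (fun x => (⟨g x, u x⟩ : TangentBundle (𝓡∂ 2) S)) x₀

section Frames

variable {X : Type*} [TopologicalSpace X] {g : X → S} {x₀ : X}
  {u v u' v' : X → EuclideanSpace ℝ (Fin 2)}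

theorem ContAlong.base (h : ContAlong g u x₀) : ContinuousAt g x₀ :=
  ((FiberBundle.continuousAt_totalSpace _ _).1 h).1

theorem contAlong_iff : ContAlong g u x₀ ↔ ContinuousAt g x₀ ∧
    ContinuousAt (fun x => tangentCoordChange (𝓡∂ 2) (g x) (g x₀) (g x) (u x)) x₀ :=
  FiberBundle.continuousAt_totalSpace _ _

theorem coordChange_self (p : S) (w : EuclideanSpace ℝ (Fin 2)) :
    tangentCoordChange (𝓡∂ 2) p p p w = w :=
  tangentCoordChange_self (mem_extChartAt_source p)

/-- Two continuous frames keep their relative orientation locally. -/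
theorem frames_eventually (hu : ContAlong g u x₀) (hv : ContAlong g v x₀)
    (hu' : ContAlong g u' x₀) (hv' : ContAlong g v' x₀)
    (h : det2 (u x₀) (v x₀) ≠ 0) (h' : det2 (u' x₀) (v' x₀) ≠ 0) :
    ∀ᶠ x in 𝓝 x₀, 0 < (det2 (u x) (v x) * det2 (u' x) (v' x)) *
      (det2 (u x₀) (v x₀) * det2 (u' x₀) (v' x₀)) := by
  -- In the chart at `g x₀` the vectors are continuous. Passing to it multiplies both determinants
  -- at `x` by the same Jacobian, which enters the product squared.
  set J : X → EuclideanSpace ℝ (Fin 2) →L[ℝ] EuclideanSpace ℝ (Fin 2) :=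
    fun x => tangentCoordChange (𝓡∂ 2) (g x) (g x₀) (g x) with hJ
  have hJ0 : ∀ w, J x₀ w = w := fun w => coordChange_self _ _
  have c := ((continuousAt_det2 (contAlong_iff.1 hu).2 (contAlong_iff.1 hv).2).mul
    (continuousAt_det2 (contAlong_iff.1 hu').2 (contAlong_iff.1 hv').2)).mul
    (continuousAt_const (y := det2 (u x₀) (v x₀) * det2 (u' x₀) (v' x₀)))
  have hpos : 0 < (det2 (J x₀ (u x₀)) (J x₀ (v x₀)) * det2 (J x₀ (u' x₀)) (J x₀ (v' x₀))) *
      (det2 (u x₀) (v x₀) * det2 (u' x₀) (v' x₀)) := by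
    simp only [hJ0]
    exact mul_self_pos.2 (mul_ne_zero h h')
  filter_upwards [c.eventually (lt_mem_nhds hpos)] with x hx
  have hd := det2_map (J x)
  have hx' : 0 < (det2 (J x (u x)) (J x (v x)) * det2 (J x (u' x)) (J x (v' x))) *
      (det2 (u x₀) (v x₀) * det2 (u' x₀) (v' x₀)) := hx
  rw [hd, hd] at hx'
  refine pos_of_mul_pos_right (a := jac (J x) ^ 2) ?_ (sq_nonneg _)
  linarith

end Frames

theorem continuous_constVec {F : Type*} [NormedAddCommGroup F] [NormedSpace ℝ F] (e : F) :
    Continuous fun z : F => (⟨z, e⟩ : TangentBundle 𝓘(ℝ, F) F) := by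
  rw [continuous_iff_continuousAt]
  intro z
  rw [FiberBundle.continuousAt_totalSpace]
  refine ⟨continuousAt_id, ?_⟩
  simpa using continuousAt_const

theorem contAlong_mfderiv {F : Type*} [NormedAddCommGroup F] [NormedSpace ℝ F] {f : F → S}
    (hf : ContMDiff 𝓘(ℝ, F) (𝓡∂ 2) ∞ f) (e : F) (z : F) :
    ContAlong f (fun z => mfderiv 𝓘(ℝ, F) (𝓡∂ 2) f z e) z :=
  ((hf.continuous_tangentMap (by simp)).comp (continuous_constVec e)).continuousAt

theorem ContAlong.comp {X Y : Type*} [TopologicalSpace X] [TopologicalSpace Y] {g : X → S}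
    {u : X → EuclideanSpace ℝ (Fin 2)} {f : Y → X} {y : Y} (h : ContAlong g u (f y))
    (hf : ContinuousAt f y) : ContAlong (g ∘ f) (u ∘ f) y :=
  ContinuousAt.comp (f := f) (g := fun x => (⟨g x, u x⟩ : TangentBundle (𝓡∂ 2) S)) h hf

theorem ContAlong.congr {X : Type*} [TopologicalSpace X] {g g' : X → S}
    {u u' : X → EuclideanSpace ℝ (Fin 2)} {x : X} (h : ContAlong g u x)
    (hg : g =ᶠ[𝓝 x] g') (hu : u =ᶠ[𝓝 x] u') : ContAlong g' u' x := by
  refine ContinuousAt.congr h ?_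
  filter_upwards [hg, hu] with y h1 h2
  rw [h1, h2]

theorem ContAlong.map {X : Type*} [TopologicalSpace X] {g : X → S}
    {u : X → EuclideanSpace ℝ (Fin 2)} {x : X} (h : ContAlong g u x) {Φ : S → S}
    (hΦ : ContMDiff (𝓡∂ 2) (𝓡∂ 2) ∞ Φ) :
    ContAlong (Φ ∘ g) (fun y => mfderiv (𝓡∂ 2) (𝓡∂ 2) Φ (g y) (u y)) x :=
  ((hΦ.continuous_tangentMap (by simp)).continuousAt).comp h

theorem ContAlong.smul_add_smul {X : Type*} [TopologicalSpace X] {g : X → S}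
    {u v : X → EuclideanSpace ℝ (Fin 2)} {x : X} (hu : ContAlong g u x) (hv : ContAlong g v x)
    {a b : X → ℝ} (ha : ContinuousAt a x) (hb : ContinuousAt b x) :
    ContAlong g (fun y => a y • u y + b y • v y) x := by
  refine contAlong_iff.2 ⟨hu.base, ?_⟩
  simp only [map_add, map_smul]
  exact (ha.smul (contAlong_iff.1 hu).2).add (hb.smul (contAlong_iff.1 hv).2)

theorem FieldAlong.contAlong {γ : ℝ → S} (L : FieldAlong γ) (t : ℝ) : ContAlong γ L.vec t :=
  L.continuous.continuousAt

/-! ### Orientations of the surface along a curve. -/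

/-- An orientation of the surface along the curve `γ`: `val t` is positive or negative according
to whether the orientation at `t` is the one given by the preferred chart at `γ t`. -/
structure OrientationAlong (γ : ℝ → S) where
  val : ℝ → ℝ
  periodic : ∀ t, val (t + 1) = val t
  frame : ∀ t₀, ∃ u v : ℝ → EuclideanSpace ℝ (Fin 2), ContAlong γ u t₀ ∧ ContAlong γ v t₀ ∧
    ∀ᶠ t in 𝓝 t₀, 0 < val t * det2 (u t) (v t)

theorem OrientationAlong.ne_zero {γ : ℝ → S} (o : OrientationAlong γ) (t : ℝ) : o.val t ≠ 0 := by
  obtain ⟨u, v, -, -, h⟩ := o.frame t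
  intro h0
  have := h.self_of_nhds
  rw [h0] at this
  simp at this

/-- Orientations compared with a continuous frame keep their sign locally. -/
theorem OrientationAlong.eventually_pos {γ : ℝ → S} (o : OrientationAlong γ) {t₀ : ℝ}
    {u v : ℝ → EuclideanSpace ℝ (Fin 2)} (hu : ContAlong γ u t₀) (hv : ContAlong γ v t₀)
    (h : det2 (u t₀) (v t₀) ≠ 0) :
    ∀ᶠ t in 𝓝 t₀, 0 < (o.val t * det2 (u t) (v t)) * (o.val t₀ * det2 (u t₀) (v t₀)) := by
  obtain ⟨u', v', hu', hv', h'⟩ := o.frame t₀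
  have h0 := h'.self_of_nhds
  have hne : det2 (u' t₀) (v' t₀) ≠ 0 := fun e => by simp [e] at h0
  filter_upwards [h', frames_eventually hu hv hu' hv' h hne] with t h1 h2
  have h3 := mul_pos (mul_pos h1 h0) h2
  have h4 : (o.val t * det2 (u' t) (v' t)) * (o.val t₀ * det2 (u' t₀) (v' t₀)) *
      (det2 (u t) (v t) * det2 (u' t) (v' t) * (det2 (u t₀) (v t₀) * det2 (u' t₀) (v' t₀))) =
      (det2 (u' t) (v' t) * det2 (u' t₀) (v' t₀)) ^ 2 *
      ((o.val t * det2 (u t) (v t)) * (o.val t₀ * det2 (u t₀) (v t₀))) := by ring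
  rw [h4] at h3
  exact pos_of_mul_pos_right h3 (sq_nonneg _)

/-- Both orientations are compared with one continuous frame, whose determinants then enter squared.
The preferred chart may jump with `t`, but the product of the two values does not notice. -/
theorem OrientationAlong.eventually_mul {γ : ℝ → S} (o o' : OrientationAlong γ) (t₀ : ℝ) :
    ∀ᶠ t in 𝓝 t₀, 0 < (o.val t * o'.val t) * (o.val t₀ * o'.val t₀) := by
  obtain ⟨u, v, hu, hv, h⟩ := o'.frame t₀
  have h0 := h.self_of_nhds
  have hne : det2 (u t₀) (v t₀) ≠ 0 := fun e => by simp [e] at h0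
  filter_upwards [h, o.eventually_pos hu hv hne] with t h1 h2
  have h3 := mul_pos (mul_pos h1 h0) h2
  have h4 : (o'.val t * det2 (u t) (v t)) * (o'.val t₀ * det2 (u t₀) (v t₀)) *
      ((o.val t * det2 (u t) (v t)) * (o.val t₀ * det2 (u t₀) (v t₀))) =
      (det2 (u t) (v t) * det2 (u t₀) (v t₀)) ^ 2 *
      ((o.val t * o'.val t) * (o.val t₀ * o'.val t₀)) := by ring
  rw [h4] at h3
  exact pos_of_mul_pos_right h3 (sq_nonneg _)

/-- A function whose sign is locally constant on a preconnected set has constant sign. -/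
theorem mul_pos_of_preconnected {f : ℝ → ℝ} {s : Set ℝ} (hs : IsPreconnected s)
    (h : ∀ x ∈ s, ∀ᶠ y in 𝓝 x, 0 < f y * f x) {x y : ℝ} (hx : x ∈ s) (hy : y ∈ s) :
    0 < f x * f y := by
  have key : ∀ a b : ℝ, 0 < a * b → SignType.sign a = SignType.sign b := by
    intro a b hab
    rcases pos_and_pos_or_neg_and_neg_of_mul_pos hab with ⟨h1, h2⟩ | ⟨h1, h2⟩
    · rw [sign_pos h1, sign_pos h2]
    · rw [sign_neg h1, sign_neg h2]
  have hc : ContinuousOn (fun x => SignType.sign (f x)) s := by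
    intro x hx
    refine ContinuousAt.continuousWithinAt ?_
    refine ContinuousAt.congr (continuousAt_const (y := SignType.sign (f x))) ?_
    filter_upwards [h x hx] with y hy
    exact (key _ _ hy).symm
  have e : SignType.sign (f x) = SignType.sign (f y) := hs.constant hc hx hy
  have hxx : f x ≠ 0 := fun h0 => by simpa [h0] using (h x hx).self_of_nhds
  rcases lt_or_gt_of_ne hxx with h1 | h1
  · rw [sign_neg h1] at e
    exact mul_pos_of_neg_of_neg h1 (sign_eq_neg_one_iff.1 e.symm)
  · rw [sign_pos h1] at e
    exact mul_pos h1 (sign_eq_one_iff.1 e.symm)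

/-- The relative sign is locally constant and the parameter line is connected. -/
theorem OrientationAlong.same_or_opposite {γ : ℝ → S} (o o' : OrientationAlong γ) :
    (∀ t, 0 < o.val t * o'.val t) ∨ ∀ t, o.val t * o'.val t < 0 := by
  have h : ∀ t, 0 < (o.val t * o'.val t) * (o.val 0 * o'.val 0) := fun t =>
    mul_pos_of_preconnected (f := fun t => o.val t * o'.val t) isPreconnected_univ
      (fun x _ => o.eventually_mul o' x) (mem_univ t) (mem_univ 0)
  rcases lt_or_gt_of_ne (mul_ne_zero (o.ne_zero 0) (o'.ne_zero 0)) with h0 | h0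
  · exact Or.inr fun t => neg_of_mul_pos_left (h t) h0.le
  · exact Or.inl fun t => pos_of_mul_pos_left (h t) h0.le

/-! ## Velocities and labelings -/

theorem velocity_contAlong (C : GenericCurve S) (t : ℝ) :
    ContAlong C.toFun (velocity C.toFun) t :=
  contAlong_mfderiv C.smooth (1 : ℝ) t

/-- The orientation along a curve for which (velocity, labeling field) is positive. -/
def Labeling.orientation {C : GenericCurve S} (L : Labeling C) : OrientationAlong C.toFun where
  val t := det2 (velocity C.toFun t) (L.vec t)
  periodic t := by rw [velocity_periodic, L.periodic]
  frame t₀ := ⟨_, _, velocity_contAlong C t₀, L.toFieldAlong.contAlong t₀,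
    Eventually.of_forall fun t => mul_self_pos.2 ((det2_ne_zero_iff _ _).2 (L.transverse t))⟩

/-- A change of chart multiplies numerator and denominator by the same Jacobian, so the quotient can
be computed in the fixed chart at `g x`. -/
theorem ContAlong.ratio {X : Type*} [TopologicalSpace X] {g : X → S} {x : X}
    {u v u' v' : X → EuclideanSpace ℝ (Fin 2)} (hu : ContAlong g u x) (hv : ContAlong g v x)
    (hu' : ContAlong g u' x) (hv' : ContAlong g v' x) (h : det2 (u' x) (v' x) ≠ 0) :
    ContinuousAt (fun y => det2 (u y) (v y) / det2 (u' y) (v' y)) x := by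
  have c1 := continuousAt_det2 (contAlong_iff.1 hu).2 (contAlong_iff.1 hv).2
  have c2 := continuousAt_det2 (contAlong_iff.1 hu').2 (contAlong_iff.1 hv').2
  have h0 : det2 (tangentCoordChange (𝓡∂ 2) (g x) (g x) (g x) (u' x))
      (tangentCoordChange (𝓡∂ 2) (g x) (g x) (g x) (v' x)) ≠ 0 := by
    rwa [coordChange_self, coordChange_self]
  refine (c1.div c2 h0).congr ?_
  filter_upwards [c2.eventually_ne h0] with y hy
  have hd := det2_map (tangentCoordChange (𝓡∂ 2) (g y) (g x) (g y))
  rw [hd] at hy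
  simp only [Pi.div_apply, hd]
  rw [mul_div_mul_left _ _ (left_ne_zero_of_mul hy)]

/-- The velocity turned by a quarter turn in a global frame is a transverse field; its coefficients
are ratios of determinants, hence continuous. -/
theorem GenericCurve.PseudoClassical.nonempty_labeling {C : GenericCurve S}
    (h : C.PseudoClassical) : Nonempty (Labeling C) := by
  obtain ⟨E, F, hEF⟩ := h
  have hne : ∀ t, det2 (E.vec t) (F.vec t) ≠ 0 := fun t => (det2_ne_zero_iff _ _).2 (hEF t)
  refine ⟨⟨⟨fun t => (-(det2 (E.vec t) (velocity C.toFun t) / det2 (E.vec t) (F.vec t))) • E.vec t +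
    (det2 (velocity C.toFun t) (F.vec t) / det2 (E.vec t) (F.vec t)) • F.vec t, ?_, ?_⟩, ?_⟩⟩
  · intro t
    simp only [E.periodic, F.periodic, velocity_periodic]
  · rw [continuous_iff_continuousAt]
    intro t
    have hE := E.contAlong t
    have hF := F.contAlong t
    have hv := velocity_contAlong C t
    exact hE.smul_add_smul hF (hE.ratio hv hE hF (hne t)).neg (hv.ratio hF hE hF (hne t))
  · intro t
    exact (det2_ne_zero_iff _ _).1 (det2_rotated_ne_zero (C.immersion t) (hne t))

end

section

/-! ### Closing up arcs whose end points lie in a chart. -/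

section CloseUp

variable {S V : Type*} [AddCommGroup V] [Module ℝ V] {ψ : V → S} {r : S → V}

/-- The curve `f` on `[0, 1]` closed up by the segment from `f 1` to `f 0` in a chart. -/
def closeUp (ψ : V → S) (r : S → V) (f : ℝ → S) (x : ℝ) : S :=
  if x ≤ 1 / 2 then f (2 * x) else ψ (r (f 1) + (2 * x - 1) • (r (f 0) - r (f 1)))

theorem closeUp_zero (f : ℝ → S) : closeUp ψ r f 0 = f 0 := by simp [closeUp]

theorem closeUp_one (hψr : ∀ p ∈ range ψ, ψ (r p) = p) {f : ℝ → S} (h : f 0 ∈ range ψ) :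
    closeUp ψ r f 1 = f 0 := by
  have : ¬ (1 : ℝ) ≤ 1 / 2 := by norm_num
  unfold closeUp
  rw [if_neg this]
  norm_num
  exact hψr _ h

end CloseUp

/-! ## Loop classes -/

section LoopClasses

variable {S : Type*} [TopologicalSpace S]

theorem monomial_swap (N : AddSubgroup GaussianInt) (z : GaussianInt) (c d : LoopClass S) :
    monomial N z c d = monomial N z d c := by
  unfold monomial
  by_cases hc : c.Contractible <;> by_cases hd : d.Contractible <;> simp [hc, hd]
  exact congrArg (fun q => Finsupp.single q (z : GaussianInt ⧸ N)) Sym2.eq_swap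

theorem monomial_of_contractible (N : AddSubgroup GaussianInt) (z : GaussianInt)
    {c : LoopClass S} (d : LoopClass S) (h : c.Contractible) : monomial N z c d = 0 := by
  simp [monomial, h]

theorem monomial_add (N : AddSubgroup GaussianInt) (z w : GaussianInt) (c d : LoopClass S) :
    monomial N z c d + monomial N w c d = monomial N (z + w) c d := by
  unfold monomial
  split_ifs
  · rw [← Finsupp.single_add]; rfl
  · simp

theorem monomial_of_mem (N : AddSubgroup GaussianInt) {z : GaussianInt} (hz : z ∈ N)
    (c d : LoopClass S) : monomial N z c d = 0 := by
  unfold monomial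
  split_ifs
  · rw [(QuotientAddGroup.eq_zero_iff z).2 hz, Finsupp.single_zero]
  · rfl

theorem conjCoeff_monomial (N : AddSubgroup GaussianInt) (hN : N ≤ N.comap conjR)
    (z : GaussianInt) (c d : LoopClass S) :
    conjCoeff N hN (monomial N z c d) = monomial N (conjR z) c d := by
  unfold monomial conjCoeff
  split_ifs
  · rw [Finsupp.mapRange_single]; rfl
  · exact Finsupp.mapRange_zero

/-- Conjugation of the coefficients as an additive map. -/
def conjCoeffHom (N : AddSubgroup GaussianInt) (hN : N ≤ N.comap conjR) :
    SymTensor S N →+ SymTensor S N :=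
  Finsupp.mapRange.addMonoidHom (QuotientAddGroup.map N N conjR hN)

theorem conjCoeffHom_apply (N : AddSubgroup GaussianInt) (hN : N ≤ N.comap conjR)
    (a : SymTensor S N) : conjCoeffHom N hN a = conjCoeff N hN a := rfl

/-- The closed curve given by a function on `[0, 1]` with equal values at the end points. -/
def loopOf (f : ℝ → S) (hf : ContinuousOn f (Icc 0 1)) (h : f 0 = f 1) :
    C(AddCircle (1 : ℝ), S) where
  toFun := AddCircle.liftIco 1 0 f
  continuous_toFun := AddCircle.liftIco_zero_continuous h hf

theorem loopOf_coe (f : ℝ → S) (hf : ContinuousOn f (Icc 0 1)) (h : f 0 = f 1) (x : ℝ) :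
    loopOf f hf h (x : AddCircle (1 : ℝ)) = f (Int.fract x) := by
  have e : (x : AddCircle (1 : ℝ)) = ((Int.fract x : ℝ) : AddCircle (1 : ℝ)) := by
    refine (QuotientAddGroup.eq_iff_sub_mem.2 (AddSubgroup.mem_zmultiples_iff.2 ⟨⌊x⌋, ?_⟩))
    rw [Int.self_sub_fract]; simp
  rw [e]
  exact AddCircle.liftIco_zero_coe_apply ⟨Int.fract_nonneg x, Int.fract_lt_one x⟩

theorem loopOf_congr {f g : ℝ → S} (hf : ContinuousOn f (Icc 0 1)) (hf' : f 0 = f 1)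
    (hg : ContinuousOn g (Icc 0 1)) (hg' : g 0 = g 1) (h : EqOn f g (Icc 0 1)) :
    loopOf f hf hf' = loopOf g hg hg' := by
  ext x
  obtain ⟨x, rfl⟩ := QuotientAddGroup.mk_surjective x
  exact (loopOf_coe _ _ _ x).trans
    ((h ⟨Int.fract_nonneg x, (Int.fract_lt_one x).le⟩).trans (loopOf_coe _ _ _ x).symm)

/-- A continuous family of closed curves is a free homotopy. -/
theorem loopClass_eq_of_family {f g : ℝ → S} (hf : ContinuousOn f (Icc 0 1)) (hf' : f 0 = f 1)
    (hg : ContinuousOn g (Icc 0 1)) (hg' : g 0 = g 1) (F : unitInterval → ℝ → S)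
    (hF : Continuous (Function.uncurry F)) (h : ∀ u, F u 0 = F u 1)
    (h0 : EqOn f (F 0) (Icc 0 1)) (h1 : EqOn g (F 1) (Icc 0 1)) :
    loopClass (loopOf f hf hf') = loopClass (loopOf g hg hg') := by
  have hc : Continuous fun p : unitInterval × ℝ => F p.1 (Int.fract p.2) :=
    hF.continuousOn.comp_fract' h
  -- The quotient `ℝ → ℝ/ℤ` is open, so its product with the interval is again a quotient map, and
  -- continuity of the homotopy can be checked on `[0, 1] × ℝ`.
  have q : IsOpenQuotientMap (Prod.map (id : unitInterval → unitInterval)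
      (QuotientAddGroup.mk : ℝ → AddCircle (1 : ℝ))) :=
    IsOpenQuotientMap.id.prodMap QuotientAddGroup.isOpenQuotientMap_mk
  have hcont : ∀ u : unitInterval, ContinuousOn (F u) (Icc 0 1) := fun u =>
    (hF.comp (f := fun x : ℝ => (u, x)) (by fun_prop)).continuousOn
  rw [loopOf_congr hf hf' (hcont 0) (h 0) h0, loopOf_congr hg hg' (hcont 1) (h 1) h1]
  refine Quotient.sound ⟨⟨⟨fun p => loopOf (F p.1) (hcont p.1) (h p.1) p.2, ?_⟩, ?_, ?_⟩⟩
  · refine q.isQuotientMap.continuous_iff.2 (hc.congr ?_)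
    rintro ⟨u, x⟩
    exact (loopOf_coe _ _ _ x).symm
  · intro x; rfl
  · intro x; rfl

theorem loopClass_contractible_of_family {f : ℝ → S} (hf : ContinuousOn f (Icc 0 1))
    (hf' : f 0 = f 1) (F : unitInterval → ℝ → S) (hF : Continuous (Function.uncurry F))
    (h : ∀ u, F u 0 = F u 1) (h0 : EqOn f (F 0) (Icc 0 1)) (p : S) (h1 : ∀ x, F 1 x = p) :
    (loopClass (loopOf f hf hf')).Contractible := by
  refine ⟨p, (loopClass_eq_of_family hf hf' (continuousOn_const (c := p)) rfl F hF h h0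
    (fun x _ => (h1 x).symm)).trans ?_⟩
  congr 1

section Closing

variable {V : Type*} [NormedAddCommGroup V] [NormedSpace ℝ V] {ψ : V → S} {r : S → V}

theorem continuous_closeUp {X : Type*} [TopologicalSpace X] (hψ : Continuous ψ)
    (hr : ContinuousOn r (range ψ)) (hψr : ∀ p ∈ range ψ, ψ (r p) = p) {F : X → ℝ → S}
    (hF : Continuous (Function.uncurry F)) (h0 : ∀ u, F u 0 ∈ range ψ)
    (h1 : ∀ u, F u 1 ∈ range ψ) :
    Continuous (Function.uncurry fun u => closeUp ψ r (F u)) := by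
  have c0 : Continuous fun u => r (F u 0) :=
    hr.comp_continuous (hF.comp (f := fun u => (u, (0 : ℝ))) (by fun_prop)) h0
  have c1 : Continuous fun u => r (F u 1) :=
    hr.comp_continuous (hF.comp (f := fun u => (u, (1 : ℝ))) (by fun_prop)) h1
  refine Continuous.if_le (f' := fun p : X × ℝ => F p.1 (2 * p.2))
    (g' := fun p : X × ℝ => ψ (r (F p.1 1) + (2 * p.2 - 1) • (r (F p.1 0) - r (F p.1 1))))
    (hF.comp (f := fun p : X × ℝ => (p.1, 2 * p.2)) (by fun_prop))
    (hψ.comp ((c1.comp continuous_fst).add (Continuous.smul (by fun_prop)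
      ((c0.comp continuous_fst).sub (c1.comp continuous_fst)))))
    continuous_snd continuous_const ?_
  rintro ⟨u, x⟩ rfl
  norm_num
  exact (hψr _ (h1 u)).symm

/-- For a closed `f` the closing segment is constant, so `closeUp` runs `f` at double speed and then
rests. The homotopy changes the speed from `1` to `2`. -/
theorem loopClass_closeUp
    (hψr : ∀ p ∈ range ψ, ψ (r p) = p) {f : ℝ → S} (hf : Continuous f) (h : f 0 = f 1)
    (h0 : f 0 ∈ range ψ) (hc : ContinuousOn (closeUp ψ r f) (Icc 0 1))
    (hc' : closeUp ψ r f 0 = closeUp ψ r f 1) :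
    loopClass (loopOf f hf.continuousOn h) = loopClass (loopOf (closeUp ψ r f) hc hc') := by
  refine loopClass_eq_of_family _ _ _ _ (fun v x => f (min ((1 + v) * x) 1)) ?_ ?_ ?_ ?_
  · exact hf.comp (by fun_prop)
  · intro u
    have h2 : min ((1 + (u : ℝ)) * 1) 1 = 1 := min_eq_right (by linarith [u.2.1])
    simp only [h2]
    simpa using h
  · intro x hx
    simp [min_eq_left hx.2]
  · intro x hx
    unfold closeUp
    simp only [Set.Icc.coe_one]
    split_ifs with hx2
    · rw [min_eq_left (by linarith)]; norm_num
    · rw [min_eq_right (by linarith), h]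
      simpa using hψr _ (h ▸ h0)

/-- A continuous family of curves with end points in a chart is a free homotopy between the
closed ones among them. -/
theorem loopClass_eq_of_closable_family (hψ : Continuous ψ) (hr : ContinuousOn r (range ψ))
    (hψr : ∀ p ∈ range ψ, ψ (r p) = p) (F : unitInterval → ℝ → S)
    (hF : Continuous (Function.uncurry F)) (h0 : ∀ u, F u 0 ∈ range ψ)
    (h1 : ∀ u, F u 1 ∈ range ψ) {f g : ℝ → S} (hf : Continuous f) (hg : Continuous g)
    (hf' : f 0 = f 1) (hg' : g 0 = g 1) (hfF : F 0 = f) (hgF : F 1 = g) :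
    loopClass (loopOf f hf.continuousOn hf') = loopClass (loopOf g hg.continuousOn hg') := by
  subst hfF hgF
  have hc := continuous_closeUp hψ hr hψr hF h0 h1
  have hcu : ∀ u, ContinuousOn (closeUp ψ r (F u)) (Icc 0 1) := fun u =>
    (hc.comp (f := fun x : ℝ => (u, x)) (by fun_prop)).continuousOn
  have he : ∀ u, closeUp ψ r (F u) 0 = closeUp ψ r (F u) 1 := fun u => by
    rw [closeUp_zero, closeUp_one hψr (h0 u)]
  rw [loopClass_closeUp hψr hf hf' (h0 0) (hcu 0) (he 0),
    loopClass_closeUp hψr hg hg' (h0 1) (hcu 1) (he 1)]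
  exact loopClass_eq_of_family _ _ _ _ (fun u => closeUp ψ r (F u)) hc he
    (fun _ _ => rfl) (fun _ _ => rfl)

end Closing

end LoopClasses

/-! ## The invariant of an oriented curve -/

section Delta

variable {S : Type*} [TopologicalSpace S] [ChartedSpace (EuclideanHalfSpace 2) S]

theorem GenericCurve.continuous (C : GenericCurve S) : Continuous C.toFun := C.smooth.continuous

theorem GenericCurve.periodic_int (C : GenericCurve S) (t : ℝ) (n : ℤ) :
    C.toFun (t + n) = C.toFun t := by
  have : Function.Periodic C.toFun 1 := C.periodic
  simpa using this.int_mul n t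

open Classical in
/-- The class of the closed curve running along `C` from `a` to `b`. -/
def GenericCurve.arcClass (C : GenericCurve S) (a b : ℝ) : LoopClass S :=
  if h : C.toFun a = C.toFun b then loopClass (subloop C.toFun C.continuous a b h)
  -- An arbitrary value for arcs that are not closed; at crossings it does not occur.
  else loopClass (ContinuousMap.const _ (C.toFun 0))

theorem GenericCurve.continuous_arc (C : GenericCurve S) (a b : ℝ) :
    Continuous fun x => C.toFun (a + (b - a) * x) :=
  C.continuous.comp (by fun_prop)

theorem GenericCurve.arc_closed (C : GenericCurve S) {a b : ℝ} (h : C.toFun a = C.toFun b) :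
    C.toFun (a + (b - a) * 0) = C.toFun (a + (b - a) * 1) := by simpa using h

theorem GenericCurve.arcClass_eq (C : GenericCurve S) {a b : ℝ} (h : C.toFun a = C.toFun b) :
    C.arcClass a b = loopClass (loopOf (fun x => C.toFun (a + (b - a) * x))
      (C.continuous_arc a b).continuousOn (C.arc_closed h)) := by
  unfold GenericCurve.arcClass
  rw [dif_pos h]
  rfl

theorem GenericCurve.arcClass_add_int (C : GenericCurve S) {a b : ℝ}
    (h : C.toFun a = C.toFun b) (n : ℤ) : C.arcClass (a + n) (b + n) = C.arcClass a b := by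
  have h' : C.toFun (a + n) = C.toFun (b + n) := by rw [C.periodic_int, C.periodic_int, h]
  rw [C.arcClass_eq h, C.arcClass_eq h']
  congr 1
  refine loopOf_congr _ _ _ _ fun x _ => ?_
  have e : a + n + (b + n - (a + n)) * x = a + (b - a) * x + n := by ring
  simp only [e, C.periodic_int]

/-- The sign of a crossing of an oriented curve as a flat self-intersection point. -/
def flatCoeff (γ : ℝ → S) (o : ℝ → ℝ) (s t : ℝ) : GaussianInt :=
  if 0 < o s * o t then 1
  else if o s * det2 (velocity γ s) (velocity γ t) < 0 then ⟨0, 1⟩ else ⟨0, -1⟩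

/-- In the imaginary case `o s` and `o t` have opposite signs, and the determinant is antisymmetric;
the two changes of sign cancel. -/
theorem flatCoeff_swap {γ : ℝ → S} {o : ℝ → ℝ} {s t : ℝ} (hs : o s ≠ 0) (ht : o t ≠ 0)
    (h : det2 (velocity γ s) (velocity γ t) ≠ 0) : flatCoeff γ o t s = flatCoeff γ o s t := by
  unfold flatCoeff
  rw [det2_swap (velocity γ s)]
  rcases lt_or_gt_of_ne hs with a | a <;> rcases lt_or_gt_of_ne ht with b | b <;>
    rcases lt_or_gt_of_ne h with c | c <;>
    simp [a, b, c, a.not_gt, b.not_gt, c.not_gt, mul_neg_iff, mul_pos_iff]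

/-- The coefficient depends only on the signs of the two quantities entering it. -/
theorem flatCoeff_congr {γ γ' : ℝ → S} {o o' : ℝ → ℝ} {s t s' t' : ℝ}
    (h1 : 0 < o s * o t * (o' s' * o' t'))
    (h2 : 0 < (o s * det2 (velocity γ s) (velocity γ t)) *
      (o' s' * det2 (velocity γ' s') (velocity γ' t'))) :
    flatCoeff γ o s t = flatCoeff γ' o' s' t' := by
  unfold flatCoeff
  generalize o s * o t = a at *
  generalize o' s' * o' t' = b at *
  generalize o s * det2 (velocity γ s) (velocity γ t) = c at *
  generalize o' s' * det2 (velocity γ' s') (velocity γ' t') = d at *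
  have e1 : 0 < a ↔ 0 < b := ⟨fun h => pos_of_mul_pos_right h1 h.le,
    fun h => pos_of_mul_pos_left h1 h.le⟩
  have e2 : c < 0 ↔ d < 0 := ⟨fun h => neg_of_mul_pos_right h2 h.le,
    fun h => neg_of_mul_pos_left h2 h.le⟩
  simp only [e1, e2]

/-- The invariant of the curve `C` with orientation `o` of the surface along it. -/
def GenericCurve.delta (C : GenericCurve S) (N : AddSubgroup GaussianInt) (o : ℝ → ℝ) :
    SymTensor S N :=
  ∑ᶠ p ∈ crossings C.toFun, monomial N (flatCoeff C.toFun o p.1 p.2)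
    (C.arcClass p.1 p.2) (C.arcClass p.2 (p.1 + 1))

theorem GenericCurve.det2_velocity_ne_zero (C : GenericCurve S) {p : ℝ × ℝ}
    (hp : p ∈ crossings C.toFun) : det2 (velocity C.toFun p.1) (velocity C.toFun p.2) ≠ 0 :=
  (det2_ne_zero_iff _ _).2 (C.transverse p hp)

variable [IsManifold (𝓡∂ 2) ∞ S]

/-- If the field at `a` is `p • v - q • w` with `v`, `w` the two velocities, then `det2 v` of it is
`-q * det2 v w`, so `q > 0` means that these determinants have opposite signs. -/
theorem Labeling.rightAtInput_iff {C : GenericCurve S} (L : Labeling C) {a b : ℝ}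
    (h : det2 (velocity C.toFun a) (velocity C.toFun b) ≠ 0) :
    L.RightAtInput a b ↔
      L.orientation.val a * det2 (velocity C.toFun a) (velocity C.toFun b) < 0 := by
  change (∃ p q : ℝ, 0 < q ∧ L.vec a = p • velocity C.toFun a - q • velocity C.toFun b) ↔
    det2 (velocity C.toFun a) (L.vec a) * _ < 0
  generalize velocity C.toFun a = v at *
  generalize velocity C.toFun b = w at *
  generalize L.vec a = l at *
  constructor
  · rintro ⟨p, q, hq, e⟩
    have : det2 v l = -(q * det2 v w) := by
      have e0 : l 0 = p * v 0 - q * w 0 := by rw [e]; simp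
      have e1 : l 1 = p * v 1 - q * w 1 := by rw [e]; simp
      unfold det2; rw [e0, e1]; ring
    rw [this]
    nlinarith [mul_pos hq (mul_self_pos.2 h)]
  · intro hneg
    -- Cramer's rule for the coordinates of `l` in the basis `v, w`.
    refine ⟨det2 l w / det2 v w, -(det2 v l / det2 v w), ?_, ?_⟩
    · have : -(det2 v l / det2 v w) = -(det2 v l * det2 v w) / (det2 v w * det2 v w) := by
        field_simp
      rw [this]
      exact div_pos (by linarith) (mul_self_pos.2 h)
    · ext i
      have : det2 v w * l i = det2 l w * v i + det2 v l * w i := by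
        fin_cases i <;> simp [det2] <;> ring
      simp only [PiLp.sub_apply, PiLp.smul_apply, smul_eq_mul]
      field_simp
      linarith

/-- The determinant changes sign when the branches are exchanged. Hence exactly one of the two
`RightAtInput` conditions holds when the orientations agree, giving sign `±1`; otherwise both or
neither hold, giving `±i`. -/
theorem Diagram.flatSign_eq (D : Diagram S) (L : Labeling D.toGenericCurve)
    (x : crossings D.toFun) :
    D.flatSign L x = flatCoeff D.toFun L.orientation.val x.1.1 x.1.2 := by
  have hne := D.det2_velocity_ne_zero x.2
  have key : ∀ a b : ℝ, det2 (velocity D.toFun a) (velocity D.toFun b) ≠ 0 →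
      D.upper x = a → D.lower x = b →
      D.flatSign L x = flatCoeff D.toFun L.orientation.val a b := by
    intro a b hab ha hb
    have hba : det2 (velocity D.toFun b) (velocity D.toFun a) ≠ 0 := by
      rw [det2_swap]; exact neg_ne_zero.2 hab
    have na := L.orientation.ne_zero a
    have nb := L.orientation.ne_zero b
    unfold Diagram.flatSign Diagram.sign flatCoeff
    rw [ha, hb, L.rightAtInput_iff hab, L.rightAtInput_iff hba, det2_swap (velocity D.toFun a)]
    generalize L.orientation.val a = p at *
    generalize L.orientation.val b = q at *
    generalize det2 (velocity D.toFun a) (velocity D.toFun b) = d at *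
    have i1 : (1 : GaussianInt) ≠ ⟨0, 1⟩ := by decide
    have i2 : (1 : GaussianInt) ≠ ⟨0, -1⟩ := by decide
    have i3 : (-1 : GaussianInt) ≠ ⟨0, 1⟩ := by decide
    have i4 : (-1 : GaussianInt) ≠ ⟨0, -1⟩ := by decide
    rcases lt_or_gt_of_ne na with a | a <;> rcases lt_or_gt_of_ne nb with b | b <;>
      rcases lt_or_gt_of_ne hab with c | c <;>
      simp [a, b, c, a.not_gt, b.not_gt, c.not_gt, mul_neg_iff, mul_pos_iff, i1, i2, i3, i4]
  cases hfo : D.firstOver x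
  · have hne' : det2 (velocity D.toFun x.1.2) (velocity D.toFun x.1.1) ≠ 0 := by
      rw [det2_swap]; exact neg_ne_zero.2 hne
    rw [key x.1.2 x.1.1 hne' (by simp [Diagram.upper, hfo]) (by simp [Diagram.lower, hfo]),
      flatCoeff_swap (L.orientation.ne_zero _) (L.orientation.ne_zero _) hne]
  · exact key _ _ hne (by simp [Diagram.upper, hfo]) (by simp [Diagram.lower, hfo])

theorem Diagram.deltaBar_eq (D : Diagram S) (N : AddSubgroup GaussianInt)
    (L : Labeling D.toGenericCurve) :
    D.deltaBar N L = D.toGenericCurve.delta N L.orientation.val := by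
  unfold Diagram.deltaBar GenericCurve.delta
  rw [← finsum_set_coe_eq_finsum_mem]
  refine finsum_congr fun x => ?_
  have h1 : D.toGenericCurve.arcClass x.1.1 x.1.2 = loopClass (D.loopFirst x) :=
    dif_pos x.2.2.2.2
  have h2 : D.toGenericCurve.arcClass x.1.2 (x.1.1 + 1) = loopClass (D.loopSecond x) :=
    dif_pos (by rw [D.periodic, x.2.2.2.2])
  rw [h1, h2, D.flatSign_eq]
  unfold Diagram.l₁ Diagram.l₂
  cases D.firstOver x
  · exact monomial_swap _ _ _ _
  · rfl

/-- Reversing the orientation along the curve conjugates the invariant. -/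
theorem GenericCurve.delta_conj (C : GenericCurve S) (N : AddSubgroup GaussianInt)
    (hN : N ≤ N.comap conjR) (o o' : OrientationAlong C.toFun) :
    EqUpToConj N hN (C.delta N o.val) (C.delta N o'.val) := by
  rcases o.same_or_opposite o' with h | h
  · left
    refine finsum_mem_congr rfl fun p hp => ?_
    congr 1
    have hd := mul_self_pos.2 (C.det2_velocity_ne_zero hp)
    refine flatCoeff_congr ?_ ?_
    · linarith [mul_pos (h p.1) (h p.2)]
    · linarith [mul_pos (h p.1) hd]
  -- The product `o s * o t` keeps its sign and `o s * det` changes it, so precisely the values `i`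
  -- and `-i` are exchanged.
  · right
    rw [← conjCoeffHom_apply]
    unfold GenericCurve.delta
    rw [AddMonoidHom.map_finsum_mem _ _ C.finite_crossings]
    refine finsum_mem_congr rfl fun p hp => ?_
    rw [conjCoeffHom_apply, conjCoeff_monomial]
    congr 1
    have hd := C.det2_velocity_ne_zero hp
    have h1 := h p.1
    have h2 := h p.2
    have j1 : conjR 1 = 1 := rfl
    have j2 : conjR ⟨0, 1⟩ = ⟨0, -1⟩ := rfl
    have j3 : conjR ⟨0, -1⟩ = ⟨0, 1⟩ := rfl
    unfold flatCoeff
    rw [apply_ite conjR, apply_ite conjR, j1, j2, j3]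
    generalize o.val p.1 = a at *
    generalize o.val p.2 = b at *
    generalize o'.val p.1 = a' at *
    generalize o'.val p.2 = b' at *
    generalize det2 (velocity C.toFun p.1) (velocity C.toFun p.2) = d at *
    rcases mul_neg_iff.1 h1 with ⟨e1, e2⟩ | ⟨e1, e2⟩ <;>
      rcases mul_neg_iff.1 h2 with ⟨e3, e4⟩ | ⟨e3, e4⟩ <;>
      rcases lt_or_gt_of_ne hd with c | c <;>
      simp [e1, e2, e3, e4, c, e1.not_gt, e2.not_gt, e3.not_gt, e4.not_gt, c.not_gt, mul_neg_iff,
        mul_pos_iff]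

end Delta

end

section

/-! ### Matching finite sums, and parameters modulo 1. -/

/-- Finite sums over sets in bijection via a relation that preserves the summands agree. -/
theorem finsum_mem_eq_of_rel {α β M : Type*} [AddCommMonoid M] {s : Set α} {t : Set β}
    {f : α → M} {g : β → M} (R : α → β → Prop) (h₁ : ∀ x ∈ s, ∃ y ∈ t, R x y)
    (h₂ : ∀ y ∈ t, ∃ x ∈ s, R x y)
    (u₁ : ∀ x ∈ s, ∀ y ∈ t, ∀ y' ∈ t, R x y → R x y' → y = y')
    (u₂ : ∀ y ∈ t, ∀ x ∈ s, ∀ x' ∈ s, R x y → R x' y → x = x')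
    (h : ∀ x ∈ s, ∀ y ∈ t, R x y → f x = g y) :
    ∑ᶠ x ∈ s, f x = ∑ᶠ y ∈ t, g y := by
  rcases isEmpty_or_nonempty β with hβ | hβ
  · have hs : s = ∅ := eq_empty_of_forall_notMem fun x hx => by
      obtain ⟨y, -⟩ := h₁ x hx
      exact hβ.elim y
    have ht : t = ∅ := eq_empty_of_forall_notMem fun y => hβ.elim y
    rw [hs, ht, finsum_mem_empty, finsum_mem_empty]
  · choose! φ hφ hR using h₁
    refine finsum_mem_eq_of_bijOn φ ⟨hφ, ?_, ?_⟩ fun x hx => h x hx _ (hφ x hx) (hR x hx)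
    · intro x hx x' hx' e
      exact u₂ (φ x) (hφ x hx) x hx x' hx' (hR x hx) (e ▸ hR x' hx')
    · intro y hy
      obtain ⟨x, hx, hxy⟩ := h₂ y hy
      exact ⟨x, hx, u₁ x hx _ (hφ x hx) _ hy (hR x hx) hxy⟩

theorem eq_and_eq_zero_of_add_int {x y : ℝ} {n : ℤ} (hx : x ∈ Ico (0 : ℝ) 1)
    (hy : y ∈ Ico (0 : ℝ) 1) (h : x = y + n) : x = y ∧ n = 0 := by
  have h1 : (n : ℝ) < 1 := by linarith [hx.2, hy.1]
  have h2 : (-1 : ℝ) < n := by linarith [hx.1, hy.2]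
  have h3 : n < 1 := by exact_mod_cast h1
  have h4 : -1 < n := by exact_mod_cast h2
  have : n = 0 := by omega
  exact ⟨by simpa [this] using h, this⟩

variable {S : Type*} [TopologicalSpace S] [ChartedSpace (EuclideanHalfSpace 2) S]

/-! ## Ambient isotopies and reparametrizations -/

/-- The derivative of a diffeomorphism in the preferred charts. -/
def diffeoDeriv (Φ : S ≃ₘ^∞⟮𝓡∂ 2, 𝓡∂ 2⟯ S) (p : S) :
    EuclideanSpace ℝ (Fin 2) →L[ℝ] EuclideanSpace ℝ (Fin 2) :=
  mfderiv (𝓡∂ 2) (𝓡∂ 2) Φ p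

theorem jac_symm_mul_jac (Φ : S ≃ₘ^∞⟮𝓡∂ 2, 𝓡∂ 2⟯ S) (p : S) :
    jac (diffeoDeriv Φ.symm (Φ p)) * jac (diffeoDeriv Φ p) = 1 := by
  refine jac_mul_of_leftInverse fun w => ?_
  have h := mfderiv_comp p (Φ.symm.mdifferentiable (by simp) (Φ p))
    (Φ.mdifferentiable (by simp) p)
  have e : Φ.symm ∘ Φ = id := funext Φ.symm_apply_apply
  rw [e, mfderiv_id] at h
  exact (congrArg (fun A : EuclideanSpace ℝ (Fin 2) →L[ℝ] EuclideanSpace ℝ (Fin 2) => A w) h).symm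

theorem jac_diffeoDeriv_ne_zero (Φ : S ≃ₘ^∞⟮𝓡∂ 2, 𝓡∂ 2⟯ S) (p : S) :
    jac (diffeoDeriv Φ p) ≠ 0 := right_ne_zero_of_mul_eq_one (jac_symm_mul_jac Φ p)

theorem velocity_diffeo_comp (C : GenericCurve S) (Φ : S ≃ₘ^∞⟮𝓡∂ 2, 𝓡∂ 2⟯ S) {θ : ℝ → ℝ}
    (hθ : Differentiable ℝ θ) (t : ℝ) :
    velocity (fun t => Φ (C.toFun (θ t))) t =
      deriv θ t • diffeoDeriv Φ (C.toFun (θ t)) (velocity C.toFun (θ t)) := by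
  have hΦ : MDifferentiable (𝓡∂ 2) (𝓡∂ 2) Φ := Φ.mdifferentiable (by simp)
  have h := velocity_comp (γ := Φ ∘ C.toFun) (hΦ.comp C.mdifferentiable) (hθ t)
  have h2 : velocity (Φ ∘ C.toFun) (θ t) =
      diffeoDeriv Φ (C.toFun (θ t)) (velocity C.toFun (θ t)) :=
    congrArg (fun A : ℝ →L[ℝ] EuclideanSpace ℝ (Fin 2) => A 1)
      (mfderiv_comp (θ t) (hΦ _) (C.mdifferentiable _))
  rw [← h2, ← h]
  rfl

theorem flatCoeff_add_int (C : GenericCurve S) {o : ℝ → ℝ} (ho : ∀ t, o (t + 1) = o t)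
    (s t : ℝ) (m n : ℤ) : flatCoeff C.toFun o (s + m) (t + n) = flatCoeff C.toFun o s t := by
  have h1 : ∀ (t : ℝ) (n : ℤ), o (t + n) = o t := fun t n => by
    simpa using (show Function.Periodic o 1 from ho).int_mul n t
  have h2 : ∀ (t : ℝ) (n : ℤ), velocity C.toFun (t + n) = velocity C.toFun t := fun t n => by
    simpa using (show Function.Periodic (velocity C.toFun) 1 from velocity_periodic C).int_mul n t
  unfold flatCoeff
  simp only [h1, h2]

section Isotopy

variable {C C' : GenericCurve S} {H : ℝ → (S ≃ₘ^∞⟮𝓡∂ 2, 𝓡∂ 2⟯ S)} {θ : ℝ → ℝ}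

/-- The isotopy runs while the affine parametrization from `θ a` to `θ b` is deformed linearly into
`θ` of the affine one. The end parameters stay `θ a` and `θ b`, so every intermediate curve is
closed. -/
theorem arcClass_isotopy (hH : Continuous fun p : ℝ × S => H p.1 p.2) (hH0 : ∀ x, H 0 x = x)
    (hθ : Continuous θ) (hC : ∀ t, C'.toFun t = H 1 (C.toFun (θ t))) {a b : ℝ}
    (h : C'.toFun a = C'.toFun b) : C'.arcClass a b = C.arcClass (θ a) (θ b) := by
  have h' : C.toFun (θ a) = C.toFun (θ b) := by
    rw [hC, hC] at h
    exact (H 1).injective h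
  rw [C'.arcClass_eq h, C.arcClass_eq h']
  symm
  refine loopClass_eq_of_family _ _ _ _ (fun u x => H u (C.toFun
    ((1 - u) * (θ a + (θ b - θ a) * x) + u * θ (a + (b - a) * x)))) ?_ ?_ ?_ ?_
  · refine hH.comp (f := fun p : unitInterval × ℝ => ((p.1 : ℝ), C.toFun
      ((1 - p.1) * (θ a + (θ b - θ a) * p.2) + p.1 * θ (a + (b - a) * p.2)))) ?_
    have := C.continuous
    fun_prop
  · intro u
    have e0 : (1 - (u : ℝ)) * (θ a + (θ b - θ a) * 0) + u * θ (a + (b - a) * 0) = θ a := by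
      simp; ring
    have e1 : (1 - (u : ℝ)) * (θ a + (θ b - θ a) * 1) + u * θ (a + (b - a) * 1) = θ b := by
      simp; ring
    simp only [e0, e1, h']
  · intro x _
    simp [hH0]
  · intro x _
    simp [hC]

/-- The crossing `y` of `C` is the one with the parameters `θ x.1`, `θ x.2` modulo `1`. -/
def CrossingRel (θ : ℝ → ℝ) (x y : ℝ × ℝ) : Prop :=
  (∃ m : ℤ, θ x.1 = y.1 + m ∧ θ x.2 = y.2 + m) ∨
    -- Here the base point lies between the two image parameters, so reduction to `[0, 1)` reverses
    -- their order.
    ∃ m : ℤ, θ x.1 = y.2 + m ∧ θ x.2 = y.1 + m + 1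

theorem map_add_int (hθ1 : ∀ t, θ (t + 1) = θ t + 1) (t : ℝ) (n : ℤ) : θ (t + n) = θ t + n := by
  have hp : Function.Periodic (fun t => θ t - t) 1 := fun t => by simp only [hθ1]; ring
  have := hp.int_mul n t
  simp only [mul_one] at this
  linarith

/-- From `s < t < s + 1` follows `θ s < θ t < θ s + 1`. After subtracting `⌊θ s⌋` the second value
is either below `1` or one further unit must be removed; these are the two cases of `CrossingRel`.
The inverse of `θ` is treated alike. -/
theorem sum_crossings_reparam {M : Type*} [AddCommMonoid M] {f g : ℝ × ℝ → M}
    (hθs : StrictMono θ) (hθc : Function.Surjective θ) (hθ1 : ∀ t, θ (t + 1) = θ t + 1)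
    (hC : ∀ s t, C'.toFun s = C'.toFun t ↔ C.toFun (θ s) = C.toFun (θ t))
    (h : ∀ x ∈ crossings C'.toFun, ∀ y ∈ crossings C.toFun, CrossingRel θ x y → f x = g y) :
    ∑ᶠ x ∈ crossings C'.toFun, f x = ∑ᶠ y ∈ crossings C.toFun, g y := by
  have hn := map_add_int hθ1
  refine finsum_mem_eq_of_rel (CrossingRel θ) ?_ ?_ ?_ ?_ h
  · rintro ⟨s, t⟩ ⟨h0, hst, h1, e⟩
    simp only at h0 hst h1 e
    rw [hC] at e
    have l1 := hθs hst
    have l2 : θ t < θ s + 1 := by rw [← hθ1]; exact hθs (by linarith)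
    have f1 := Int.floor_le (θ s)
    have f2 := Int.lt_floor_add_one (θ s)
    have c1 : C.toFun (θ s - ⌊θ s⌋) = C.toFun (θ s) := by
      simpa [sub_eq_add_neg] using C.periodic_int (θ s) (-⌊θ s⌋)
    by_cases hb : θ t - ⌊θ s⌋ < 1
    · refine ⟨(θ s - ⌊θ s⌋, θ t - ⌊θ s⌋), ⟨by simp only; linarith, by simp only; linarith, hb, ?_⟩,
        Or.inl ⟨⌊θ s⌋, by simp, by simp⟩⟩
      have c2 : C.toFun (θ t - ⌊θ s⌋) = C.toFun (θ t) := by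
        simpa [sub_eq_add_neg] using C.periodic_int (θ t) (-⌊θ s⌋)
      simp only [c1, c2, e]
    · refine ⟨(θ t - ⌊θ s⌋ - 1, θ s - ⌊θ s⌋), ⟨by simp only; linarith, by simp only; linarith,
        by simp only; linarith, ?_⟩, Or.inr ⟨⌊θ s⌋, by simp, by simp only; ring⟩⟩
      have c2 : C.toFun (θ t - ⌊θ s⌋ - 1) = C.toFun (θ t) := by
        have := C.periodic_int (θ t) (-⌊θ s⌋ - 1)
        rw [← this]; congr 1; push_cast; ring
      simp only [c1, c2, e]
  · rintro ⟨s, t⟩ ⟨h0, hst, h1, e⟩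
    simp only at h0 hst h1 e
    obtain ⟨a, rfl⟩ := hθc s
    obtain ⟨b, rfl⟩ := hθc t
    rw [← hC] at e
    have l1 : a < b := hθs.lt_iff_lt.1 hst
    have l2 : b < a + 1 := hθs.lt_iff_lt.1 (by rw [hθ1]; linarith)
    have f1 := Int.floor_le a
    have f2 := Int.lt_floor_add_one a
    have c1 : C'.toFun (a - ⌊a⌋) = C'.toFun a := by
      simpa [sub_eq_add_neg] using C'.periodic_int a (-⌊a⌋)
    have t1 : θ (a - ⌊a⌋) = θ a - ⌊a⌋ := by simpa [sub_eq_add_neg] using hn a (-⌊a⌋)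
    by_cases hb : b - ⌊a⌋ < 1
    · have t2 : θ (b - ⌊a⌋) = θ b - ⌊a⌋ := by simpa [sub_eq_add_neg] using hn b (-⌊a⌋)
      refine ⟨(a - ⌊a⌋, b - ⌊a⌋), ⟨by simp only; linarith, by simp only; linarith, hb, ?_⟩,
        Or.inl ⟨-⌊a⌋, ?_, ?_⟩⟩
      · have c2 : C'.toFun (b - ⌊a⌋) = C'.toFun b := by
          simpa [sub_eq_add_neg] using C'.periodic_int b (-⌊a⌋)
        simp only [c1, c2, e]
      · simp only [t1]; push_cast; ring
      · simp only [t2]; push_cast; ring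
    · have e2 : b - ⌊a⌋ - 1 = b + ((-⌊a⌋ - 1 : ℤ) : ℝ) := by push_cast; ring
      refine ⟨(b - ⌊a⌋ - 1, a - ⌊a⌋), ⟨by simp only; linarith, by simp only; linarith,
        by simp only; linarith, ?_⟩, Or.inr ⟨-⌊a⌋ - 1, ?_, ?_⟩⟩
      · simp only [e2, C'.periodic_int, c1, e]
      · simp only [e2, hn]
      · simp only [t1]; push_cast; ring
  · rintro ⟨s, t⟩ - ⟨a, b⟩ ⟨h0, hab, h1, -⟩ ⟨a', b'⟩ ⟨h0', hab', h1', -⟩ hR hR'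
    simp only [CrossingRel] at *
    have ma : a ∈ Ico (0 : ℝ) 1 := ⟨h0, by linarith⟩
    have mb : b ∈ Ico (0 : ℝ) 1 := ⟨by linarith, h1⟩
    have ma' : a' ∈ Ico (0 : ℝ) 1 := ⟨h0', by linarith⟩
    have mb' : b' ∈ Ico (0 : ℝ) 1 := ⟨by linarith, h1'⟩
    rcases hR with ⟨m, e1, e2⟩ | ⟨m, e1, e2⟩ <;> rcases hR' with ⟨n, e3, e4⟩ | ⟨n, e3, e4⟩
    · rw [(eq_and_eq_zero_of_add_int (n := n - m) ma ma' (by push_cast; linarith)).1,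
        (eq_and_eq_zero_of_add_int (n := n - m) mb mb' (by push_cast; linarith)).1]
    -- The mixed cases would make two consecutive integers vanish.
    · have h2 := (eq_and_eq_zero_of_add_int (n := n - m) ma mb' (by push_cast; linarith))
      have h3 := (eq_and_eq_zero_of_add_int (n := n - m + 1) mb ma' (by push_cast; linarith))
      omega
    · have h2 := (eq_and_eq_zero_of_add_int (n := n - m) mb ma' (by push_cast; linarith))
      have h3 := (eq_and_eq_zero_of_add_int (n := n - m - 1) ma mb' (by push_cast; linarith))
      omega
    · rw [(eq_and_eq_zero_of_add_int (n := n - m) ma ma' (by push_cast; linarith)).1,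
        (eq_and_eq_zero_of_add_int (n := n - m) mb mb' (by push_cast; linarith)).1]
  · rintro ⟨s, t⟩ - ⟨a, b⟩ ⟨h0, hab, h1, -⟩ ⟨a', b'⟩ ⟨h0', hab', h1', -⟩ hR hR'
    simp only [CrossingRel] at *
    have ma : a ∈ Ico (0 : ℝ) 1 := ⟨h0, by linarith⟩
    have mb : b ∈ Ico (0 : ℝ) 1 := ⟨by linarith, h1⟩
    have ma' : a' ∈ Ico (0 : ℝ) 1 := ⟨h0', by linarith⟩
    have mb' : b' ∈ Ico (0 : ℝ) 1 := ⟨by linarith, h1'⟩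
    have inj : ∀ (x y : ℝ) (n : ℤ), θ x = θ y + n → x = y + n := fun x y n e =>
      hθs.injective (by rw [hn, e])
    rcases hR with ⟨m, e1, e2⟩ | ⟨m, e1, e2⟩ <;> rcases hR' with ⟨n, e3, e4⟩ | ⟨n, e3, e4⟩
    · rw [(eq_and_eq_zero_of_add_int ma ma' (inj _ _ (m - n) (by push_cast; linarith))).1,
        (eq_and_eq_zero_of_add_int mb mb' (inj _ _ (m - n) (by push_cast; linarith))).1]
    · have h2 := eq_and_eq_zero_of_add_int ma mb' (inj _ _ (m - n - 1) (by push_cast; linarith))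
      have h3 := eq_and_eq_zero_of_add_int mb ma' (inj _ _ (m - n) (by push_cast; linarith))
      omega
    · have h2 := eq_and_eq_zero_of_add_int mb ma' (inj _ _ (m - n + 1) (by push_cast; linarith))
      have h3 := eq_and_eq_zero_of_add_int ma mb' (inj _ _ (m - n) (by push_cast; linarith))
      omega
    · rw [(eq_and_eq_zero_of_add_int ma ma' (inj _ _ (m - n) (by push_cast; linarith))).1,
        (eq_and_eq_zero_of_add_int mb mb' (inj _ _ (m - n) (by push_cast; linarith))).1]

end Isotopy

variable [IsManifold (𝓡∂ 2) ∞ S]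

/-- Transport of an orientation along a curve under a diffeomorphism and a reparametrization. -/
def OrientationAlong.transport {γ : ℝ → S} (o : OrientationAlong γ)
    (Φ : S ≃ₘ^∞⟮𝓡∂ 2, 𝓡∂ 2⟯ S) {θ : ℝ → ℝ} (hθ : Continuous θ)
    (hθ1 : ∀ t, θ (t + 1) = θ t + 1) (hγ : ∀ t, γ (t + 1) = γ t) :
    OrientationAlong fun t => Φ (γ (θ t)) where
  val t := o.val (θ t) * jac (diffeoDeriv Φ (γ (θ t)))
  periodic t := by rw [hθ1, o.periodic, hγ]
  frame t₀ := by
    obtain ⟨u, v, hu, hv, h⟩ := o.frame (θ t₀)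
    refine ⟨_, _, (hu.comp hθ.continuousAt).map Φ.contMDiff,
      (hv.comp hθ.continuousAt).map Φ.contMDiff, ?_⟩
    filter_upwards [hθ.continuousAt.eventually h] with t ht
    have e := det2_map (diffeoDeriv Φ (γ (θ t))) (u (θ t)) (v (θ t))
    have e' : 0 < (o.val (θ t) * jac (diffeoDeriv Φ (γ (θ t)))) *
        det2 (diffeoDeriv Φ (γ (θ t)) (u (θ t))) (diffeoDeriv Φ (γ (θ t)) (v (θ t))) := by
      rw [e]
      nlinarith [mul_pos ht (mul_self_pos.2 (jac_diffeoDeriv_ne_zero Φ (γ (θ t))))]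
    exact e'

section Isotopy

variable {C C' : GenericCurve S} {H : ℝ → (S ≃ₘ^∞⟮𝓡∂ 2, 𝓡∂ 2⟯ S)} {θ : ℝ → ℝ}

/-- Both velocities at a crossing are mapped by one differential and scaled by positive derivatives
of `θ`. The determinant acquires the Jacobian that the orientation acquires too, so it enters
squared. -/
theorem delta_isotopy (N : AddSubgroup GaussianInt)
    (hH : Continuous fun p : ℝ × S => H p.1 p.2) (hH0 : ∀ x, H 0 x = x)
    (hθ : Differentiable ℝ θ) (hθ1 : ∀ t, θ (t + 1) = θ t + 1) (hθd : ∀ t, 0 < deriv θ t)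
    (hθs : Function.Surjective θ)
    (hC : ∀ t, C'.toFun t = H 1 (C.toFun (θ t))) (o : OrientationAlong C.toFun)
    (o' : OrientationAlong C'.toFun)
    (hoo : ∀ t, 0 < o'.val t * (o.val (θ t) * jac (diffeoDeriv (H 1) (C.toFun (θ t))))) :
    C.delta N o.val = C'.delta N o'.val := by
  symm
  have hfun : C'.toFun = fun t => H 1 (C.toFun (θ t)) := funext hC
  refine sum_crossings_reparam (strictMono_of_deriv_pos hθd) hθs hθ1 ?_ ?_
  · intro s t
    rw [hC, hC]
    exact (H 1).injective.eq_iff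
  · intro x hx y hy hR
    have hne := C'.det2_velocity_ne_zero hx
    have hx1 : C'.toFun x.2 = C'.toFun (x.1 + 1) := by rw [C'.periodic, hx.2.2.2]
    have hpt : C.toFun (θ x.1) = C.toFun (θ x.2) := (H 1).injective
      ((hC _).symm.trans (hx.2.2.2.trans (hC _)))
    have k1 := hoo x.1
    have k2 := hoo x.2
    have hcoef : flatCoeff C'.toFun o'.val x.1 x.2 =
        flatCoeff C.toFun o.val (θ x.1) (θ x.2) := by
      have ev : det2 (velocity C'.toFun x.1) (velocity C'.toFun x.2) =
          (deriv θ x.1 * deriv θ x.2) * (jac (diffeoDeriv (H 1) (C.toFun (θ x.2))) *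
          det2 (velocity C.toFun (θ x.1)) (velocity C.toFun (θ x.2))) := by
        rw [hfun, velocity_diffeo_comp C _ hθ, velocity_diffeo_comp C _ hθ, hpt, ← det2_map]
        simp only [det2, PiLp.smul_apply, smul_eq_mul]
        ring
      rw [ev] at hne
      have hd := mul_pos (hθd x.1) (hθd x.2)
      have hne2 := right_ne_zero_of_mul hne
      rw [hpt] at k1
      have hJ := mul_self_pos.2 (left_ne_zero_of_mul hne2)
      have hD := mul_self_pos.2 (right_ne_zero_of_mul hne2)
      refine flatCoeff_congr ?_ ?_
      · have := mul_pos k1 k2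
        refine pos_of_mul_pos_left (b := jac (diffeoDeriv (H 1) (C.toFun (θ x.2))) *
          jac (diffeoDeriv (H 1) (C.toFun (θ x.2)))) ?_ hJ.le
        linarith
      · rw [ev]
        have := mul_pos (mul_pos k1 hD) hd
        linarith
    have ha := arcClass_isotopy hH hH0 hθ.continuous hC hx.2.2.2
    have hb := arcClass_isotopy hH hH0 hθ.continuous hC hx1
    rw [hθ1] at hb
    simp only [hcoef, ha, hb]
    have hy1 : C.toFun y.2 = C.toFun (y.1 + 1) := by rw [C.periodic, hy.2.2.2]
    rcases hR with ⟨m, e1, e2⟩ | ⟨m, e1, e2⟩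
    · have e3 : y.1 + m + 1 = y.1 + 1 + m := by ring
      rw [e1, e2, e3, flatCoeff_add_int C o.periodic, C.arcClass_add_int hy.2.2.2,
        C.arcClass_add_int hy1]
    -- The order of the parameters is reversed: the two arcs exchange roles, and the symmetry of
    -- monomials and of `flatCoeff` is needed.
    · have e3 : y.1 + m + 1 = y.1 + 1 + m := by ring
      have e4 : y.1 + m + 1 = y.1 + ((m + 1 : ℤ) : ℝ) := by push_cast; ring
      have e5 : y.2 + m + 1 = y.2 + ((m + 1 : ℤ) : ℝ) := by push_cast; ring
      rw [e1, e2, e5]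
      conv_lhs => rw [e4, flatCoeff_add_int C o.periodic, C.arcClass_add_int hy.2.2.2, ← e4, e3,
        C.arcClass_add_int hy1]
      rw [monomial_swap, flatCoeff_swap (o.ne_zero _) (o.ne_zero _) (C.det2_velocity_ne_zero hy)]

end Isotopy

/-- Both directions of the transport of orientations that preserves the invariant. -/
def DeltaCorrespond (N : AddSubgroup GaussianInt) (C C' : GenericCurve S) : Prop :=
  (∀ o : OrientationAlong C.toFun, ∃ o' : OrientationAlong C'.toFun,
    C.delta N o.val = C'.delta N o'.val) ∧
  ∀ o' : OrientationAlong C'.toFun, ∃ o : OrientationAlong C.toFun,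
    C.delta N o.val = C'.delta N o'.val

theorem IsotopyMove.deltaCorrespond {C C' : GenericCurve S} (h : IsotopyMove C C')
    (N : AddSubgroup GaussianInt) : DeltaCorrespond N C C' := by
  obtain ⟨H, θ, hH, hH0, hθ, hθ1, hθd, hC⟩ := h
  have hθdiff : Differentiable ℝ θ := hθ.differentiable (by simp)
  have hθm : StrictMono θ := strictMono_of_deriv_pos hθd
  have hn := map_add_int hθ1
  have hθs : Function.Surjective θ := by
    refine hθdiff.continuous.surjective ?_ ?_
    · refine tendsto_atTop.2 fun b => ?_
      filter_upwards [eventually_ge_atTop ((⌈b - θ 0⌉ : ℤ) : ℝ)] with t ht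
      have h1 := hθm.monotone ht
      have h2 := hn 0 ⌈b - θ 0⌉
      rw [zero_add] at h2
      linarith [Int.le_ceil (b - θ 0)]
    · refine tendsto_atBot.2 fun b => ?_
      filter_upwards [eventually_le_atBot ((⌊b - θ 0⌋ : ℤ) : ℝ)] with t ht
      have h1 := hθm.monotone ht
      have h2 := hn 0 ⌊b - θ 0⌋
      rw [zero_add] at h2
      linarith [Int.floor_le (b - θ 0)]
  have hfun : (fun t => H 1 (C.toFun (θ t))) = C'.toFun := (funext hC).symm
  constructor
  · intro o
    let o1 := o.transport (H 1) hθdiff.continuous hθ1 C.periodic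
    let o' : OrientationAlong C'.toFun := ⟨o1.val, o1.periodic, hfun ▸ o1.frame⟩
    refine ⟨o', delta_isotopy N hH.continuous hH0 hθdiff hθ1 hθd hθs hC o o' fun t => ?_⟩
    exact mul_self_pos.2 (mul_ne_zero (o.ne_zero _) (jac_diffeoDeriv_ne_zero _ _))
  · intro o'
    let e := hθm.orderIsoOfSurjective θ hθs
    have hee : ∀ t, e.symm (θ t) = t := fun t => e.symm_apply_apply t
    have hee' : ∀ t, θ (e.symm t) = t := fun t => e.apply_symm_apply t
    have he1 : ∀ t, e.symm (t + 1) = e.symm t + 1 := fun t =>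
      hθm.injective (by rw [hee', hθ1, hee'])
    let o1 := o'.transport (H 1).symm e.symm.continuous he1 C'.periodic
    have hback : (fun t => (H 1).symm (C'.toFun (e.symm t))) = C.toFun := by
      funext t
      rw [hC, hee', (H 1).symm_apply_apply]
    let o : OrientationAlong C.toFun := ⟨o1.val, o1.periodic, hback ▸ o1.frame⟩
    refine ⟨o, delta_isotopy N hH.continuous hH0 hθdiff hθ1 hθd hθs hC o o' fun t => ?_⟩
    change 0 < o'.val t * ((o'.val (e.symm (θ t)) *
      jac (diffeoDeriv (H 1).symm (C'.toFun (e.symm (θ t))))) * _)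
    rw [hee, hC, mul_assoc, jac_symm_mul_jac, mul_one]
    exact mul_self_pos.2 (o'.ne_zero t)

end

section

/-- The inverse of a planar chart. -/
def planeInv {S : Type*} (ψ : ℝ × ℝ → S) : S → ℝ × ℝ := Function.invFun ψ

theorem apply_planeInv {S : Type*} {ψ : ℝ × ℝ → S} {p : S} (hp : p ∈ range ψ) : ψ (planeInv ψ p) = p :=
  Function.invFun_eq hp

theorem mem_Ico_of_crossing {S : Type*} {γ : ℝ → S} {p : ℝ × ℝ} (hp : p ∈ crossings γ) :
    p.1 ∈ Ico (0 : ℝ) 1 ∧ p.2 ∈ Ico (0 : ℝ) 1 :=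
  ⟨⟨hp.1, hp.2.1.trans hp.2.2.1⟩, ⟨hp.1.trans hp.2.1.le, hp.2.2.1⟩⟩

variable {S : Type*} [TopologicalSpace S] [ChartedSpace (EuclideanHalfSpace 2) S]

/-! ## Planar charts -/

section Plane

variable {ψ : ℝ × ℝ → S}

theorem IsPlaneEmbedding.contMDiff (h : IsPlaneEmbedding ψ) :
    ContMDiff 𝓘(ℝ, ℝ × ℝ) (𝓡∂ 2) ∞ ψ := h.2.contMDiff

theorem IsPlaneEmbedding.isOpenEmbedding (h : IsPlaneEmbedding ψ) :
    Topology.IsOpenEmbedding ψ :=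
  .of_continuous_injective_isOpenMap h.contMDiff.continuous h.1 h.2.isOpenMap

theorem IsPlaneEmbedding.inv_apply (h : IsPlaneEmbedding ψ) (z : ℝ × ℝ) :
    planeInv ψ (ψ z) = z := Function.leftInverse_invFun h.1 z

theorem IsPlaneEmbedding.continuousAt_inv (h : IsPlaneEmbedding ψ) {p : S} (hp : p ∈ range ψ) :
    ContinuousAt (planeInv ψ) p := by
  obtain ⟨z, rfl⟩ := hp
  rw [← h.isOpenEmbedding.continuousAt_iff]
  exact continuousAt_id.congr (Eventually.of_forall fun z => (h.inv_apply z).symm)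

theorem IsPlaneEmbedding.continuousOn_inv (h : IsPlaneEmbedding ψ) :
    ContinuousOn (planeInv ψ) (range ψ) := fun _ hp => (h.continuousAt_inv hp).continuousWithinAt

/-- The derivative of a planar chart in the preferred charts. -/
def planeDeriv (ψ : ℝ × ℝ → S) (z : ℝ × ℝ) : ℝ × ℝ →L[ℝ] EuclideanSpace ℝ (Fin 2) :=
  mfderiv 𝓘(ℝ, ℝ × ℝ) (𝓡∂ 2) ψ z

/-- The Jacobian determinant of a planar chart at a point of its image. -/
def planeJac (ψ : ℝ × ℝ → S) (p : S) : ℝ :=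
  det2 (planeDeriv ψ (planeInv ψ p) (1, 0)) (planeDeriv ψ (planeInv ψ p) (0, 1))

theorem det2_planeDeriv (p : S) (a b : ℝ × ℝ) :
    det2 (planeDeriv ψ (planeInv ψ p) a) (planeDeriv ψ (planeInv ψ p) b) =
      planeJac ψ p * (a.1 * b.2 - a.2 * b.1) := by
  have h : ∀ a : ℝ × ℝ, planeDeriv ψ (planeInv ψ p) a =
      a.1 • planeDeriv ψ (planeInv ψ p) (1, 0) + a.2 • planeDeriv ψ (planeInv ψ p) (0, 1) := by
    intro a
    rw [← map_smul, ← map_smul, ← map_add]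
    congr 1
    ext <;> simp
  rw [h a, h b]
  simp only [planeJac, det2, PiLp.add_apply, PiLp.smul_apply, smul_eq_mul]
  ring

/-- The derivative of `ψ` is onto at every point of the plane, in particular at the arbitrary point
that `planeInv` assigns off the range. -/
theorem IsPlaneEmbedding.planeJac_ne_zero [IsManifold (𝓡∂ 2) ∞ S] (h : IsPlaneEmbedding ψ)
    (p : S) : planeJac ψ p ≠ 0 := by
  have hs : Function.Surjective (planeDeriv ψ (planeInv ψ p)) := by
    have e := h.2.mfderivToContinuousLinearEquiv_coe (by simp) (x := planeInv ψ p)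
    intro w
    let A := h.2.mfderivToContinuousLinearEquiv (by simp) (planeInv ψ p)
    refine ⟨A.symm w, ?_⟩
    have := A.apply_symm_apply w
    have e2 : planeDeriv ψ (planeInv ψ p) (A.symm w) = A (A.symm w) := by
      unfold planeDeriv
      rw [← e]
      rfl
    rw [e2, this]
  obtain ⟨a, ha⟩ := hs (EuclideanSpace.single 0 1)
  obtain ⟨b, hb⟩ := hs (EuclideanSpace.single 1 1)
  have := det2_planeDeriv (ψ := ψ) p a b
  rw [ha, hb] at this
  intro h0
  rw [h0] at this
  simp [det2] at this

theorem IsPlaneEmbedding.mdifferentiableAt_inv (h : IsPlaneEmbedding ψ) {p : S}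
    (hp : p ∈ range ψ) : MDifferentiableAt (𝓡∂ 2) 𝓘(ℝ, ℝ × ℝ) (planeInv ψ) p := by
  obtain ⟨z, rfl⟩ := hp
  have hz := h.2 z
  refine (hz.localInverse_mdifferentiableAt (by simp)).congr_of_eventuallyEq ?_
  filter_upwards [hz.localInverse_eventuallyEq_right] with q hq
  have hq' : ψ (hz.localInverse q) = q := hq
  have := h.inv_apply (hz.localInverse q)
  rw [hq'] at this
  exact this

theorem IsPlaneEmbedding.velocity_eq (h : IsPlaneEmbedding ψ) (C : GenericCurve S) {t : ℝ}
    (ht : C.toFun t ∈ range ψ) :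
    DifferentiableAt ℝ (fun t => planeInv ψ (C.toFun t)) t ∧
    velocity C.toFun t = planeDeriv ψ (planeInv ψ (C.toFun t))
      (deriv (fun t => planeInv ψ (C.toFun t)) t) := by
  have hd : MDifferentiableAt 𝓘(ℝ, ℝ) 𝓘(ℝ, ℝ × ℝ) (fun t => planeInv ψ (C.toFun t)) t :=
    (h.mdifferentiableAt_inv ht).comp t (C.mdifferentiable t)
  have hd' := mdifferentiableAt_iff_differentiableAt.1 hd
  refine ⟨hd', ?_⟩
  have hev : C.toFun =ᶠ[𝓝 t] ψ ∘ fun t => planeInv ψ (C.toFun t) := by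
    filter_upwards [C.continuous.continuousAt.eventually
      (h.isOpenEmbedding.isOpen_range.mem_nhds ht)] with s hs
    exact (apply_planeInv hs).symm
  rw [velocity_congr hev]
  have hψ : MDifferentiableAt 𝓘(ℝ, ℝ × ℝ) (𝓡∂ 2) ψ (planeInv ψ (C.toFun t)) :=
    h.contMDiff.mdifferentiable (by simp) _
  have e := mfderiv_comp t hψ hd
  rw [mfderiv_eq_fderiv] at e
  exact congrArg (fun A : ℝ →L[ℝ] EuclideanSpace ℝ (Fin 2) => A 1) e

end Plane

/-! ## Modifications of a curve in a disc -/

section Homotopy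

variable {ψ : ℝ × ℝ → S} {C C' : GenericCurve S}

/-- At each parameter two curves both run in a planar chart, or they coincide nearby. -/
def Parallel (ψ : ℝ × ℝ → S) (C C' : GenericCurve S) : Prop :=
  ∀ t, (C.toFun t ∈ range ψ ∧ C'.toFun t ∈ range ψ) ∨ C.toFun =ᶠ[𝓝 t] C'.toFun

theorem Parallel.refl (ψ : ℝ × ℝ → S) (C : GenericCurve S) : Parallel ψ C C :=
  fun _ => Or.inr (EventuallyEq.refl _ _)

open Classical in
/-- The straight-line homotopy in a planar chart. -/
def planeHomotopy (ψ : ℝ × ℝ → S) (C C' : GenericCurve S) (u : unitInterval) (t : ℝ) : S :=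
  if C.toFun t ∈ range ψ ∧ C'.toFun t ∈ range ψ then
    ψ (planeInv ψ (C.toFun t) + (u : ℝ) • (planeInv ψ (C'.toFun t) - planeInv ψ (C.toFun t)))
  else C.toFun t

theorem planeHomotopy_of_eq {u : unitInterval} {t : ℝ} (h : C.toFun t = C'.toFun t) :
    planeHomotopy ψ C C' u t = C.toFun t := by
  unfold planeHomotopy
  split_ifs with h1
  · rw [← h, sub_self, smul_zero, add_zero, apply_planeInv h1.1]
  · rfl

theorem planeHomotopy_mem {u : unitInterval} {t : ℝ} (h : C.toFun t ∈ range ψ)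
    (h' : C'.toFun t ∈ range ψ) : planeHomotopy ψ C C' u t ∈ range ψ := by
  unfold planeHomotopy
  rw [if_pos ⟨h, h'⟩]
  exact mem_range_self _

theorem planeHomotopy_zero (t : ℝ) : planeHomotopy ψ C C' 0 t = C.toFun t := by
  unfold planeHomotopy
  split_ifs with h1
  · rw [Set.Icc.coe_zero, zero_smul, add_zero, apply_planeInv h1.1]
  · rfl

theorem planeHomotopy_one (h : Parallel ψ C C') (t : ℝ) :
    planeHomotopy ψ C C' 1 t = C'.toFun t := by
  unfold planeHomotopy
  split_ifs with h1
  · rw [Set.Icc.coe_one, one_smul, add_sub_cancel, apply_planeInv h1.2]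
  · exact ((h t).resolve_left h1).self_of_nhds

theorem IsPlaneEmbedding.eventually_mem_range (hψ : IsPlaneEmbedding ψ) (C : GenericCurve S)
    {t : ℝ} (h : C.toFun t ∈ range ψ) : ∀ᶠ s in 𝓝 t, C.toFun s ∈ range ψ :=
  C.continuous.continuousAt.eventually (hψ.isOpenEmbedding.isOpen_range.mem_nhds h)

/-- Near a given parameter either both curves stay in the open chart and the straight-line formula
applies, or the curves coincide and nothing moves. -/
theorem continuous_planeHomotopy (hψ : IsPlaneEmbedding ψ) (h : Parallel ψ C C') :
    Continuous (Function.uncurry (planeHomotopy ψ C C')) := by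
  rw [continuous_iff_continuousAt]
  rintro ⟨u, t⟩
  rcases h t with ⟨h1, h2⟩ | h1
  · have c1 : ContinuousAt (fun p : unitInterval × ℝ => planeInv ψ (C.toFun p.2)) (u, t) :=
      ContinuousAt.comp (f := fun p : unitInterval × ℝ => C.toFun p.2) (hψ.continuousAt_inv h1)
        (C.continuous.comp continuous_snd).continuousAt
    have c2 : ContinuousAt (fun p : unitInterval × ℝ => planeInv ψ (C'.toFun p.2)) (u, t) :=
      ContinuousAt.comp (f := fun p : unitInterval × ℝ => C'.toFun p.2) (hψ.continuousAt_inv h2)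
        (C'.continuous.comp continuous_snd).continuousAt
    have c3 : ContinuousAt (fun p : unitInterval × ℝ => (p.1 : ℝ)) (u, t) := by fun_prop
    have c4 := c1.add (c3.smul (c2.sub c1))
    refine (hψ.contMDiff.continuous.continuousAt.comp c4).congr ?_
    filter_upwards [continuousAt_snd.eventually (hψ.eventually_mem_range C h1),
      continuousAt_snd.eventually (hψ.eventually_mem_range C' h2)] with p hp hp'
    exact (if_pos ⟨hp, hp'⟩).symm
  · refine ((C.continuous.comp continuous_snd).continuousAt (x := (u, t))).congr ?_
    filter_upwards [continuousAt_snd.eventually h1] with p hp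
    exact (planeHomotopy_of_eq hp).symm

theorem arcClass_eq_of_fixed (hψ : IsPlaneEmbedding ψ) (h : Parallel ψ C C') {a b : ℝ}
    (ha : C.toFun a = C'.toFun a) (hb : C.toFun b = C'.toFun b) (hab : C.toFun a = C.toFun b) :
    C.arcClass a b = C'.arcClass a b := by
  have hab' : C'.toFun a = C'.toFun b := by rw [← ha, ← hb, hab]
  rw [C.arcClass_eq hab, C'.arcClass_eq hab']
  refine loopClass_eq_of_family _ _ _ _
    (fun u x => planeHomotopy ψ C C' u (a + (b - a) * x)) ?_ ?_ ?_ ?_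
  · exact (continuous_planeHomotopy hψ h).comp
      (f := fun p : unitInterval × ℝ => (p.1, a + (b - a) * p.2)) (by fun_prop)
  · intro u
    simp only [mul_zero, add_zero, mul_one, add_sub_cancel]
    rw [planeHomotopy_of_eq ha, planeHomotopy_of_eq hb, hab]
  · intro x _
    exact (planeHomotopy_zero _).symm
  · intro x _
    exact (planeHomotopy_one h _).symm

/-- For a crossing whose parameters change. The intermediate arcs need not be closed, but their ends
remain in the chart, where segments close them up. -/
theorem arcClass_eq_of_moving (hψ : IsPlaneEmbedding ψ) (h : Parallel ψ C C') {a b a' b' : ℝ}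
    (ha : ∀ u ∈ Icc (0 : ℝ) 1, C.toFun (a + u * (a' - a)) ∈ range ψ ∧
      C'.toFun (a + u * (a' - a)) ∈ range ψ)
    (hb : ∀ u ∈ Icc (0 : ℝ) 1, C.toFun (b + u * (b' - b)) ∈ range ψ ∧
      C'.toFun (b + u * (b' - b)) ∈ range ψ)
    (hab : C.toFun a = C.toFun b) (hab' : C'.toFun a' = C'.toFun b') :
    C.arcClass a b = C'.arcClass a' b' := by
  rw [C.arcClass_eq hab, C'.arcClass_eq hab']
  refine loopClass_eq_of_closable_family hψ.contMDiff.continuous hψ.continuousOn_inv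
    (fun _ hp => apply_planeInv hp)
    (fun u x => planeHomotopy ψ C C' u ((a + u * (a' - a)) +
      ((b + u * (b' - b)) - (a + u * (a' - a))) * x)) ?_ ?_ ?_ (C.continuous_arc a b)
    (C'.continuous_arc a' b') _ _ ?_ ?_
  · exact (continuous_planeHomotopy hψ h).comp
      (f := fun p : unitInterval × ℝ => (p.1, (a + p.1 * (a' - a)) +
      ((b + p.1 * (b' - b)) - (a + p.1 * (a' - a))) * p.2)) (by fun_prop)
  · intro u
    simp only [mul_zero, add_zero]
    exact planeHomotopy_mem (ha u u.2).1 (ha u u.2).2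
  · intro u
    simp only [mul_one, add_sub_cancel]
    exact planeHomotopy_mem (hb u u.2).1 (hb u u.2).2
  · funext x
    simp [planeHomotopy_zero]
  · funext x
    simp [planeHomotopy_one h]

/-- The loop is shrunk radially to the origin of the chart. Clamping `x` to `[0, 1]` keeps the
family in the chart for all real `x`. -/
theorem arcClass_contractible (hψ : IsPlaneEmbedding ψ) {a b : ℝ} (hlt : a ≤ b)
    (hab : C.toFun a = C.toFun b) (h : ∀ t ∈ Icc a b, C.toFun t ∈ range ψ) :
    (C.arcClass a b).Contractible := by
  rw [C.arcClass_eq hab]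
  have hmem : ∀ x : ℝ, C.toFun (a + (b - a) * max 0 (min x 1)) ∈ range ψ := fun x => by
    have h0 : 0 ≤ max 0 (min x 1) := le_max_left _ _
    have h1 : max 0 (min x 1) ≤ 1 := max_le zero_le_one (min_le_right _ _)
    refine h _ ⟨?_, ?_⟩ <;> nlinarith
  have hc : Continuous fun x : ℝ => planeInv ψ (C.toFun (a + (b - a) * max 0 (min x 1))) :=
    hψ.continuousOn_inv.comp_continuous (C.continuous.comp (by fun_prop)) hmem
  refine loopClass_contractible_of_family _ _
    (fun u x => ψ ((1 - (u : ℝ)) • planeInv ψ (C.toFun (a + (b - a) * max 0 (min x 1)))))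
    ?_ ?_ ?_ (ψ 0) ?_
  · have h1 : Continuous fun p : unitInterval × ℝ => 1 - (p.1 : ℝ) := by fun_prop
    have hs : Continuous fun p : unitInterval × ℝ => (1 - (p.1 : ℝ)) •
        planeInv ψ (C.toFun (a + (b - a) * max 0 (min p.2 1))) :=
      h1.smul (hc.comp continuous_snd)
    exact hψ.contMDiff.continuous.comp hs
  · intro u
    simp [hab]
  · intro x hx
    have e : max 0 (min x 1) = x := by rw [min_eq_left hx.2, max_eq_right hx.1]
    have := apply_planeInv (hmem x)
    rw [e] at this
    simp [e, this]
  · intro x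
    simp

end Homotopy

/-! ### Carrying orientations across a modification in a chart. -/

section Orientation

variable [IsManifold (𝓡∂ 2) ∞ S] {ψ : ℝ × ℝ → S} {C C' : GenericCurve S}

theorem IsPlaneEmbedding.contAlong (hψ : IsPlaneEmbedding ψ) (C : GenericCurve S) {t : ℝ}
    (h : C.toFun t ∈ range ψ) (e : ℝ × ℝ) :
    ContAlong C.toFun (fun t => planeDeriv ψ (planeInv ψ (C.toFun t)) e) t := by
  refine ContAlong.congr ((contAlong_mfderiv hψ.contMDiff e (planeInv ψ (C.toFun t))).comp
    (f := fun t => planeInv ψ (C.toFun t))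
    (ContinuousAt.comp (hψ.continuousAt_inv h) C.continuous.continuousAt)) ?_ (EventuallyEq.refl _ _)
  filter_upwards [hψ.eventually_mem_range C h] with s hs
  exact apply_planeInv hs

theorem OrientationAlong.eventually_plane (hψ : IsPlaneEmbedding ψ)
    (o : OrientationAlong C.toFun) {t₀ : ℝ} (h : C.toFun t₀ ∈ range ψ) :
    ∀ᶠ t in 𝓝 t₀, 0 < (o.val t * planeJac ψ (C.toFun t)) *
      (o.val t₀ * planeJac ψ (C.toFun t₀)) :=
  o.eventually_pos (hψ.contAlong C h (1, 0)) (hψ.contAlong C h (0, 1)) (hψ.planeJac_ne_zero _)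

theorem OrientationAlong.plane_pos (hψ : IsPlaneEmbedding ψ) (o : OrientationAlong C.toFun)
    {J : Set ℝ} (hJ : IsPreconnected J) (h : ∀ t ∈ J, C.toFun t ∈ range ψ) {s t : ℝ}
    (hs : s ∈ J) (ht : t ∈ J) :
    0 < (o.val s * planeJac ψ (C.toFun s)) * (o.val t * planeJac ψ (C.toFun t)) :=
  mul_pos_of_preconnected (f := fun t => o.val t * planeJac ψ (C.toFun t)) hJ
    (fun _ hx => o.eventually_plane hψ (h _ hx)) hs ht

/-- Orientations along two curves that agree where the curves do, and in a planar chart. -/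
def OrientationAlong.Compat (ψ : ℝ × ℝ → S) (o : OrientationAlong C.toFun)
    (o' : OrientationAlong C'.toFun) : Prop :=
  (∀ t, C.toFun t ∈ range ψ → C'.toFun t ∈ range ψ →
    0 < (o.val t * planeJac ψ (C.toFun t)) * (o'.val t * planeJac ψ (C'.toFun t))) ∧
  ∀ t, C.toFun t = C'.toFun t → 0 < o.val t * o'.val t

theorem OrientationAlong.Compat.symm {o : OrientationAlong C.toFun}
    {o' : OrientationAlong C'.toFun} (h : o.Compat ψ o') : o'.Compat ψ o :=
  ⟨fun t h1 h2 => by rw [mul_comm]; exact h.1 t h2 h1,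
    fun t h1 => by rw [mul_comm]; exact h.2 t h1.symm⟩

-- In the chart the orientation is carried over by the coordinate frame, i.e. corrected by the
-- Jacobians at both points; elsewhere it is kept. Where the curves coincide the two rules differ by
-- a positive square.
open Classical in
theorem OrientationAlong.exists_compat (hψ : IsPlaneEmbedding ψ) (h : Parallel ψ C C')
    (o : OrientationAlong C.toFun) : ∃ o' : OrientationAlong C'.toFun, o.Compat ψ o' := by
  let val : ℝ → ℝ := fun t => if C.toFun t ∈ range ψ ∧ C'.toFun t ∈ range ψ then
    o.val t * planeJac ψ (C.toFun t) * planeJac ψ (C'.toFun t) else o.val t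
  have hpos : ∀ t, C.toFun t = C'.toFun t → ∃ c : ℝ, 0 < c ∧ val t = c * o.val t := by
    intro t ht
    by_cases hr : C.toFun t ∈ range ψ ∧ C'.toFun t ∈ range ψ
    · refine ⟨planeJac ψ (C.toFun t) * planeJac ψ (C.toFun t),
        mul_self_pos.2 (hψ.planeJac_ne_zero _), ?_⟩
      simp only [val, if_pos hr, ← ht]
      ring
    · exact ⟨1, one_pos, by simp only [val, if_neg hr, one_mul]⟩
  refine ⟨⟨val, ?_, ?_⟩, ?_, ?_⟩
  · intro t
    simp only [val, C.periodic, C'.periodic, o.periodic]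
  · intro t₀
    rcases h t₀ with ⟨h1, h2⟩ | h1
    -- The coordinate frame along `C'`, its first vector scaled by a constant whose sign makes the
    -- frame positive.
    · refine ⟨_, _, (hψ.contAlong C' h2 (1, 0)).smul_add_smul (hψ.contAlong C' h2 (1, 0))
        (a := fun _ => o.val t₀ * planeJac ψ (C.toFun t₀)) (b := fun _ => 0) continuousAt_const
        continuousAt_const, hψ.contAlong C' h2 (0, 1), ?_⟩
      filter_upwards [o.eventually_plane hψ h1, hψ.eventually_mem_range C h1,
        hψ.eventually_mem_range C' h2] with t ht hC hC'
      have e : ∀ (c : ℝ) (u v : EuclideanSpace ℝ (Fin 2)),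
          det2 (c • u + (0 : ℝ) • u) v = c * det2 u v := by
        intro c u v
        simp only [det2, PiLp.add_apply, PiLp.smul_apply, smul_eq_mul]
        ring
      rw [e]
      have e2 : det2 (planeDeriv ψ (planeInv ψ (C'.toFun t)) (1, 0))
        (planeDeriv ψ (planeInv ψ (C'.toFun t)) (0, 1)) = planeJac ψ (C'.toFun t) := rfl
      rw [e2]
      simp only [val, if_pos (And.intro hC hC')]
      have := mul_pos ht (mul_self_pos.2 (hψ.planeJac_ne_zero (C'.toFun t)))
      linarith
    · obtain ⟨u, v, hu, hv, huv⟩ := o.frame t₀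
      refine ⟨u, v, hu.congr h1 (EventuallyEq.refl _ _), hv.congr h1 (EventuallyEq.refl _ _), ?_⟩
      filter_upwards [huv, h1] with t ht hCt
      obtain ⟨c, hc, e⟩ := hpos t hCt
      rw [e, mul_assoc]
      exact mul_pos hc ht
  · intro t h1 h2
    have e : val t = o.val t * planeJac ψ (C.toFun t) * planeJac ψ (C'.toFun t) :=
      if_pos ⟨h1, h2⟩
    change 0 < _ * (val t * _)
    rw [e]
    have h3 := mul_self_pos.2 (mul_ne_zero (mul_ne_zero (o.ne_zero t)
      (hψ.planeJac_ne_zero (C.toFun t))) (hψ.planeJac_ne_zero (C'.toFun t)))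
    linarith
  · intro t ht
    obtain ⟨c, hc, e⟩ := hpos t ht
    change 0 < o.val t * val t
    rw [e]
    nlinarith [mul_pos hc (mul_self_pos.2 (o.ne_zero t))]

end Orientation

/-! ## Comparison of the invariants -/

section DiscMove

/-- The curves `C` and `C'` differ only on the parameters in `A`, where both run in the closed
square of the chart `ψ`; elsewhere they avoid it. -/
structure DiscMove (ψ : ℝ × ℝ → S) (A : Set ℝ) (C C' : GenericCurve S) : Prop where
  emb : IsPlaneEmbedding ψ
  closed : IsClosed A
  agree : AgreeOutside ψ A C C'
  inside : ∀ t ∈ A, C.toFun t ∈ ψ '' closedBox ∧ C'.toFun t ∈ ψ '' closedBox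

variable {ψ : ℝ × ℝ → S} {A : Set ℝ} {C C' : GenericCurve S}

theorem DiscMove.symm (h : DiscMove ψ A C C') : DiscMove ψ A C' C where
  emb := h.emb
  closed := h.closed
  agree := ⟨h.agree.1, fun t ht hA =>
    ⟨(h.agree.2 t ht hA).1.symm, (h.agree.2 t ht hA).1 ▸ (h.agree.2 t ht hA).2⟩⟩
  inside t ht := (h.inside t ht).symm

theorem GenericCurve.apply_fract (C : GenericCurve S) (t : ℝ) :
    C.toFun (Int.fract t) = C.toFun t := by
  have := C.periodic_int t (-⌊t⌋)
  rw [← this]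
  congr 1
  push_cast
  rw [← sub_eq_add_neg]
  rfl

/-- `Int.fract` jumps at integers, so the set is written as the preimage of the image of the compact
set `A` in the circle. -/
theorem isClosed_fract_preimage (hA : IsClosed A) (h : A ⊆ Ioo 0 1) :
    IsClosed {t : ℝ | Int.fract t ∈ A} := by
  have hc : IsCompact A :=
    (isCompact_Icc (a := (0 : ℝ)) (b := 1)).of_isClosed_subset hA (h.trans Ioo_subset_Icc_self)
  have hm : Continuous (QuotientAddGroup.mk : ℝ → AddCircle (1 : ℝ)) := continuous_quotient_mk'
  have e : {t : ℝ | Int.fract t ∈ A} = (QuotientAddGroup.mk : ℝ → AddCircle (1 : ℝ)) ⁻¹'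
      ((QuotientAddGroup.mk : ℝ → AddCircle (1 : ℝ)) '' A) := by
    ext t
    constructor
    · intro ht
      refine ⟨_, ht, QuotientAddGroup.eq_iff_sub_mem.2 (AddSubgroup.mem_zmultiples_iff.2
        ⟨-⌊t⌋, ?_⟩)⟩
      have := Int.self_sub_fract t
      simp only [neg_smul, zsmul_eq_mul, mul_one]
      linarith
    · rintro ⟨a, ha, hat⟩
      obtain ⟨n, hn⟩ := AddSubgroup.mem_zmultiples_iff.1 (QuotientAddGroup.eq_iff_sub_mem.1 hat)
      have e1 : Int.fract t = a := by
        have : t = a + ((-n : ℤ) : ℝ) := by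
          simp only [zsmul_eq_mul, mul_one] at hn
          push_cast
          linarith
        rw [this, Int.fract_add_intCast, Int.fract_eq_self.2 ⟨(h ha).1.le, (h ha).2⟩]
      change Int.fract t ∈ A
      rwa [e1]
  rw [e]
  exact (hc.image hm).isClosed.preimage hm

theorem DiscMove.eventuallyEq (h : DiscMove ψ A C C') {t : ℝ} (ht : Int.fract t ∉ A) :
    C.toFun =ᶠ[𝓝 t] C'.toFun := by
  have ho := (isClosed_fract_preimage h.closed h.agree.1).isOpen_compl.mem_nhds ht
  filter_upwards [ho] with s hs
  rw [← C.apply_fract, ← C'.apply_fract]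
  exact (h.agree.2 _ ⟨Int.fract_nonneg s, Int.fract_lt_one s⟩ hs).1

theorem DiscMove.parallel (h : DiscMove ψ A C C') : Parallel ψ C C' := by
  intro t
  by_cases ht : Int.fract t ∈ A
  · left
    rw [← C.apply_fract, ← C'.apply_fract]
    exact ⟨image_subset_range _ _ (h.inside _ ht).1, image_subset_range _ _ (h.inside _ ht).2⟩
  · exact Or.inr (h.eventuallyEq ht)

/-- The contribution of a crossing to the invariant. -/
def GenericCurve.term (C : GenericCurve S) (N : AddSubgroup GaussianInt) (o : ℝ → ℝ) (p : ℝ × ℝ) :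
    SymTensor S N :=
  monomial N (flatCoeff C.toFun o p.1 p.2) (C.arcClass p.1 p.2) (C.arcClass p.2 (p.1 + 1))

theorem GenericCurve.delta_split (C : GenericCurve S) (N : AddSubgroup GaussianInt) (o : ℝ → ℝ)
    (B : Set (ℝ × ℝ)) : C.delta N o =
      ∑ᶠ p ∈ crossings C.toFun ∩ B, C.term N o p + ∑ᶠ p ∈ crossings C.toFun \ B, C.term N o p :=
  (finsum_mem_inter_add_sdiff B C.finite_crossings).symm

/-- The two branches meet in one point, which lies in the square or does not. -/
theorem DiscMove.mem_iff (h : DiscMove ψ A C C') {p : ℝ × ℝ} (hp : p ∈ crossings C.toFun) :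
    p.1 ∈ A ↔ p.2 ∈ A := by
  obtain ⟨m1, m2⟩ := mem_Ico_of_crossing hp
  constructor
  · intro h1
    by_contra h2
    exact (h.agree.2 _ m2 h2).2 (hp.2.2.2 ▸ (h.inside _ h1).1)
  · intro h1
    by_contra h2
    exact (h.agree.2 _ m1 h2).2 (hp.2.2.2 ▸ (h.inside _ h1).1)

theorem DiscMove.crossings_subset (h : DiscMove ψ A C C') :
    crossings C.toFun ∩ {p | p.1 ∉ A} ⊆ crossings C'.toFun ∩ {p | p.1 ∉ A} := by
  rintro p ⟨hp, hA⟩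
  obtain ⟨m1, m2⟩ := mem_Ico_of_crossing hp
  have hA2 : p.2 ∉ A := fun h2 => hA ((h.mem_iff hp).2 h2)
  refine ⟨⟨hp.1, hp.2.1, hp.2.2.1, ?_⟩, hA⟩
  rw [← (h.agree.2 _ m1 hA).1, ← (h.agree.2 _ m2 hA2).1]
  exact hp.2.2.2

variable [IsManifold (𝓡∂ 2) ∞ S]

/-- The curves coincide near both parameters of such a crossing, hence so do the velocities; the
loops change only by the homotopy in the chart, with fixed ends. -/
theorem DiscMove.sum_outside (h : DiscMove ψ A C C') (N : AddSubgroup GaussianInt)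
    {o : OrientationAlong C.toFun} {o' : OrientationAlong C'.toFun} (hoo : o.Compat ψ o') :
    ∑ᶠ p ∈ crossings C.toFun ∩ {p | p.1 ∉ A}, C.term N o.val p =
      ∑ᶠ p ∈ crossings C'.toFun ∩ {p | p.1 ∉ A}, C'.term N o'.val p := by
  refine finsum_mem_congr (h.crossings_subset.antisymm h.symm.crossings_subset) ?_
  rintro p ⟨hp', hA⟩
  obtain ⟨hp, -⟩ := h.symm.crossings_subset ⟨hp', hA⟩
  obtain ⟨m1, m2⟩ := mem_Ico_of_crossing hp
  have hA2 : p.2 ∉ A := fun h2 => hA ((h.mem_iff hp).2 h2)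
  have e1 := (h.agree.2 _ m1 hA).1
  have e2 := (h.agree.2 _ m2 hA2).1
  have ev : ∀ t ∈ Ico (0 : ℝ) 1, t ∉ A → velocity C.toFun t = velocity C'.toFun t :=
    fun t ht hA => velocity_congr (h.eventuallyEq (by rwa [Int.fract_eq_self.2 ht]))
  unfold GenericCurve.term
  rw [arcClass_eq_of_fixed h.emb h.parallel e1 e2 hp.2.2.2,
    arcClass_eq_of_fixed h.emb h.parallel e2 (by rw [C.periodic, C'.periodic, e1])
      (by rw [C.periodic, hp.2.2.2])]
  congr 1
  have k1 := hoo.2 _ e1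
  have k2 := hoo.2 _ e2
  refine flatCoeff_congr ?_ ?_
  · linarith [mul_pos k1 k2]
  · rw [← ev _ m1 hA, ← ev _ m2 hA2]
    linarith [mul_pos k1 (mul_self_pos.2 (C.det2_velocity_ne_zero hp))]

/-- A modification in a disc preserves the invariant if it preserves the contribution of the
crossings in the disc. -/
theorem DiscMove.deltaCorrespond (h : DiscMove ψ A C C') (N : AddSubgroup GaussianInt)
    (hin : ∀ (o : OrientationAlong C.toFun) (o' : OrientationAlong C'.toFun), o.Compat ψ o' →
      ∑ᶠ p ∈ crossings C.toFun \ {p | p.1 ∉ A}, C.term N o.val p =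
        ∑ᶠ p ∈ crossings C'.toFun \ {p | p.1 ∉ A}, C'.term N o'.val p) :
    DeltaCorrespond N C C' := by
  have key : ∀ (o : OrientationAlong C.toFun) (o' : OrientationAlong C'.toFun), o.Compat ψ o' →
      C.delta N o.val = C'.delta N o'.val := fun o o' hoo => by
    rw [C.delta_split N _ {p | p.1 ∉ A}, C'.delta_split N _ {p | p.1 ∉ A},
      h.sum_outside N hoo, hin o o' hoo]
  constructor
  · intro o
    obtain ⟨o', ho'⟩ := o.exists_compat h.emb h.parallel
    exact ⟨o', key o o' ho'⟩
  · intro o'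
    obtain ⟨o, ho⟩ := o'.exists_compat h.emb h.symm.parallel
    exact ⟨o, key o o' ho.symm⟩

end DiscMove

variable [IsManifold (𝓡∂ 2) ∞ S]

theorem isCompact_closedBox : IsCompact closedBox := isCompact_Icc.prod isCompact_Icc

/-- A crossing of `C` in the disc cuts off an arc inside the disc, so its monomial is zero whatever
its coefficient; the arc of `C'` is embedded. -/
theorem MoveR1.deltaCorrespond [T2Space S] {C C' : GenericCurve S} (h : MoveR1 C C')
    (N : AddSubgroup GaussianInt) : DeltaCorrespond N C C' := by
  obtain ⟨ψ, a, b, hψ, hab, hag, hin, hinj, s₀, t₀, h1, h2, h3, he, huniq⟩ := h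
  -- Only the open interval of parameters is known to land in the square. Its end points follow by
  -- closure, since a compact set in a Hausdorff space is closed.
  have hcl : IsClosed (ψ '' closedBox) :=
    (isCompact_closedBox.image hψ.contMDiff.continuous).isClosed
  have hsub : openBox ⊆ closedBox := prod_mono Ioo_subset_Icc_self Ioo_subset_Icc_self
  have key : ∀ c : GenericCurve S, (∀ t ∈ Ioo a b, c.toFun t ∈ ψ '' openBox) →
      ∀ t ∈ Icc a b, c.toFun t ∈ ψ '' closedBox := by
    intro c hc
    have := closure_minimal (s := Ioo a b) (t := c.toFun ⁻¹' (ψ '' closedBox))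
      (fun t ht => image_mono hsub (hc t ht)) (hcl.preimage c.continuous)
    rwa [closure_Ioo hab.ne] at this
  have hd : DiscMove ψ (Icc a b) C C' := ⟨hψ, isClosed_Icc, hag, fun t ht =>
    ⟨key C (fun t ht => (hin t ht).1) t ht, key C' (fun t ht => (hin t ht).2) t ht⟩⟩
  refine hd.deltaCorrespond N fun o o' _ => ?_
  rw [finsum_mem_of_eqOn_zero, finsum_mem_of_eqOn_zero]
  · rintro p ⟨hp, hA⟩
    have hA1 : p.1 ∈ Icc a b := not_not.1 hA
    exact absurd (hinj hA1 ((hd.symm.mem_iff hp).1 hA1) hp.2.2.2) hp.2.1.ne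
  · rintro p ⟨hp, hA⟩
    have hA1 : p.1 ∈ Icc a b := not_not.1 hA
    refine monomial_of_contractible _ _ _ (arcClass_contractible hψ hp.2.1.le hp.2.2.2 fun t ht => ?_)
    exact image_subset_range _ _ (hd.inside t
      ⟨hA1.1.trans ht.1, ht.2.trans ((hd.mem_iff hp).1 hA1).2⟩).1

end

section

/-- If `u` passes from below to above `v` at `z`, then `u z = v z` and the slope of `u` is at least
that of `v`. -/
theorem eq_and_deriv_le_of_crossing {u v : ℝ → ℝ} {z u' v' : ℝ} (hu : HasDerivAt u u' z)
    (hv : HasDerivAt v v' z) (hl : ∀ᶠ x in 𝓝[<] z, u x < v x) (hr : ∀ᶠ x in 𝓝[>] z, v x < u x) :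
    u z = v z ∧ v' ≤ u' := by
  have cu := hu.continuousAt
  have cv := hv.continuousAt
  have e : u z = v z := by
    apply le_antisymm
    · exact le_of_tendsto_of_tendsto (cu.mono_left nhdsWithin_le_nhds)
        (cv.mono_left nhdsWithin_le_nhds) (hl.mono fun _ h => h.le)
    · exact le_of_tendsto_of_tendsto (cv.mono_left nhdsWithin_le_nhds)
        (cu.mono_left nhdsWithin_le_nhds) (hr.mono fun _ h => h.le)
  refine ⟨e, ?_⟩
  have hd := (hu.sub hv).hasDerivWithinAt (s := Ioi z)
  rw [hasDerivWithinAt_iff_tendsto_slope' (by simp)] at hd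
  have : 0 ≤ u' - v' := by
    refine ge_of_tendsto hd ?_
    filter_upwards [hr, self_mem_nhdsWithin] with x hx hxz
    rw [slope_def_field]
    simp only [Pi.sub_apply]
    rw [e, sub_self, sub_zero]
    exact div_nonneg (by linarith) (by linarith [mem_Ioi.1 hxz])
  linarith

variable {S : Type*} [TopologicalSpace S] [ChartedSpace (EuclideanHalfSpace 2) S]

/-! ## Strands -/

/-- The parameters of `n` strands. -/
def strandSet {n : ℕ} (c w : Fin n → ℝ) : Set ℝ :=
  {t | ∃ k, ∃ x ∈ Icc (-1 : ℝ) 1, t = c k + w k * x}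

/-- The parameters of strands are disjoint non-degenerate intervals. -/
structure StrandParam {n : ℕ} (c w : Fin n → ℝ) : Prop where
  ne_zero : ∀ k, w k ≠ 0
  disjoint : ∀ j k, j ≠ k → ∀ x ∈ Icc (-1 : ℝ) 1, ∀ y ∈ Icc (-1 : ℝ) 1,
    c j + w j * x ≠ c k + w k * y

/-- In the closed square of the chart `ψ` the curve `C` consists of the graphs of `f`. -/
structure Strands {n : ℕ} (ψ : ℝ × ℝ → S) (c w : Fin n → ℝ) (f : Fin n → ℝ → ℝ)
    (C : GenericCurve S) : Prop where
  emb : IsPlaneEmbedding ψ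
  param : StrandParam c w
  eq : ∀ k, ∀ x ∈ Icc (-1 : ℝ) 1, C.toFun (c k + w k * x) = ψ (x, f k x)

section Param

variable {n : ℕ} {c w : Fin n → ℝ}

theorem isClosed_strandSet (c w : Fin n → ℝ) : IsClosed (strandSet c w) := by
  have : strandSet c w = ⋃ k, (fun x => c k + w k * x) '' Icc (-1 : ℝ) 1 := by
    ext t
    simp only [strandSet, mem_ofPred_eq, mem_iUnion, mem_image, eq_comm (a := t)]
  rw [this]
  exact isClosed_iUnion_of_finite fun k => (isCompact_Icc.image (by fun_prop)).isClosed

theorem StrandParam.inj (h : StrandParam c w) {j k : Fin n} {x y : ℝ} (hx : x ∈ Icc (-1 : ℝ) 1)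
    (hy : y ∈ Icc (-1 : ℝ) 1) (e : c j + w j * x = c k + w k * y) : j = k ∧ x = y := by
  by_cases hjk : j = k
  · subst hjk
    exact ⟨rfl, mul_left_cancel₀ (h.ne_zero j) (add_left_cancel e)⟩
  · exact absurd e (h.disjoint j k hjk x hx y hy)

theorem segment_mem {x x' u : ℝ} {s : Set ℝ} (hs : Convex ℝ s) (hx : x ∈ s)
    (hx' : x' ∈ s) (hu : u ∈ Icc (0 : ℝ) 1) : x + u * (x' - x) ∈ s := by
  have := hs.add_smul_sub_mem hx hx' hu
  simpa using this

/-- Disjoint intervals are ordered, by the intermediate value theorem. So which of two strands is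
traversed first does not depend on the crossing. -/
theorem StrandParam.lt (h : StrandParam c w) {j k : Fin n} (hjk : j ≠ k) {x y x' y' : ℝ}
    (hx : x ∈ Icc (-1 : ℝ) 1) (hy : y ∈ Icc (-1 : ℝ) 1) (hx' : x' ∈ Icc (-1 : ℝ) 1)
    (hy' : y' ∈ Icc (-1 : ℝ) 1) (hlt : c j + w j * x < c k + w k * y) :
    c j + w j * x' < c k + w k * y' := by
  by_contra hge
  have hc : ContinuousOn (fun u : ℝ => (c j + w j * (x + u * (x' - x))) -
      (c k + w k * (y + u * (y' - y)))) (Icc 0 1) := by fun_prop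
  obtain ⟨u, hu, e⟩ := intermediate_value_Icc zero_le_one hc (show (0 : ℝ) ∈ _ from
    ⟨by simp; linarith, by simp; linarith⟩)
  exact h.disjoint j k hjk _ (segment_mem (convex_Icc _ _) hx hx' hu) _
    (segment_mem (convex_Icc _ _) hy hy' hu) (sub_eq_zero.1 e)

end Param

section Strands

variable {n : ℕ} {ψ : ℝ × ℝ → S} {c w : Fin n → ℝ} {f g : Fin n → ℝ → ℝ} {C C' : GenericCurve S}

theorem InStrandForm.data (h : InStrandForm n f g C C') : ∃ (ψ : ℝ × ℝ → S) (c w : Fin n → ℝ),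
    Strands ψ c w f C ∧ Strands ψ c w g C' ∧ DiscMove ψ (strandSet c w) C C' := by
  obtain ⟨ψ, c, w, hψ, hw, hd, hag, hk⟩ := h
  refine ⟨ψ, c, w, ⟨hψ, ⟨hw, hd⟩, fun k x hx => (hk k x hx).2.2.1⟩,
    ⟨hψ, ⟨hw, hd⟩, fun k x hx => (hk k x hx).2.2.2⟩,
    ⟨hψ, isClosed_strandSet c w, hag, ?_⟩⟩
  rintro t ⟨k, x, hx, rfl⟩
  obtain ⟨h1, h2, h3, h4⟩ := hk k x hx
  exact ⟨⟨_, ⟨hx, Ioo_subset_Icc_self h1⟩, h3.symm⟩, ⟨_, ⟨hx, Ioo_subset_Icc_self h2⟩, h4.symm⟩⟩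

theorem Strands.mem_range (h : Strands ψ c w f C) (k : Fin n) {x : ℝ} (hx : x ∈ Icc (-1 : ℝ) 1) :
    C.toFun (c k + w k * x) ∈ range ψ := by
  rw [h.eq k x hx]
  exact mem_range_self _

theorem Strands.apply_eq_iff (h : Strands ψ c w f C) {j k : Fin n} {x y : ℝ}
    (hx : x ∈ Icc (-1 : ℝ) 1) (hy : y ∈ Icc (-1 : ℝ) 1) :
    C.toFun (c j + w j * x) = C.toFun (c k + w k * y) ↔ x = y ∧ f j x = f k y := by
  rw [h.eq j x hx, h.eq k y hy, h.emb.1.eq_iff, Prod.mk.injEq]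

/-- Differentiate `C (c k + w k * x) = ψ (x, f k x)` in the chart: differentiability of `f k` is
inherited from `C`. -/
theorem Strands.hasDerivAt (h : Strands ψ c w f C) (k : Fin n) {x : ℝ}
    (hx : x ∈ Ioo (-1 : ℝ) 1) : ∃ z : ℝ × ℝ, w k * z.1 = 1 ∧ HasDerivAt (f k) (w k * z.2) x ∧
      velocity C.toFun (c k + w k * x) =
        planeDeriv ψ (planeInv ψ (C.toFun (c k + w k * x))) z := by
  obtain ⟨hd, hv⟩ := h.emb.velocity_eq C (h.mem_range k (Ioo_subset_Icc_self hx))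
  refine ⟨_, ?_, ?_, hv⟩
  all_goals
    have h1 : HasDerivAt (fun x => c k + w k * x) (w k) x := by
      simpa using ((hasDerivAt_id x).const_mul (w k)).const_add (c k)
    have h2 := HasDerivAt.scomp x hd.hasDerivAt h1
    have hev : ((fun t => planeInv ψ (C.toFun t)) ∘ fun x => c k + w k * x) =ᶠ[𝓝 x]
        fun x => (x, f k x) := by
      filter_upwards [isOpen_Ioo.mem_nhds hx] with y hy
      simp only [Function.comp_apply]
      rw [h.eq k y (Ioo_subset_Icc_self hy), h.emb.inv_apply]
    have h3 := h2.congr_of_eventuallyEq hev.symm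
  · have h4 : HasDerivAt (fun x : ℝ => x) _ x := h3.fst
    exact h4.unique (hasDerivAt_id x)
  · exact h3.snd

/-- The relative position of the velocities at a crossing of two strands is given by their
slopes. -/
theorem Strands.det2_velocity (h : Strands ψ c w f C) (j k : Fin n) {x : ℝ}
    (hx : x ∈ Ioo (-1 : ℝ) 1) (he : f j x = f k x) :
    det2 (velocity C.toFun (c j + w j * x)) (velocity C.toFun (c k + w k * x)) * (w j * w k) =
      planeJac ψ (C.toFun (c j + w j * x)) * (deriv (f k) x - deriv (f j) x) := by
  obtain ⟨z, hz, hf, hv⟩ := h.hasDerivAt j hx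
  obtain ⟨z', hz', hf', hv'⟩ := h.hasDerivAt k hx
  have hp : C.toFun (c k + w k * x) = C.toFun (c j + w j * x) :=
    (h.apply_eq_iff (Ioo_subset_Icc_self hx) (Ioo_subset_Icc_self hx)).2 ⟨rfl, he.symm⟩
  rw [hv, hv', hp, det2_planeDeriv, hf.deriv, hf'.deriv]
  linear_combination planeJac ψ (C.toFun (c j + w j * x)) *
    ((w k * z'.2) * hz - (w j * z.2) * hz')

theorem Strands.mem_crossings_iff (h : Strands ψ c w f C) (hd : DiscMove ψ (strandSet c w) C C')
    {p : ℝ × ℝ} : p ∈ crossings C.toFun \ {p | p.1 ∉ strandSet c w} ↔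
      ∃ j k, ∃ x ∈ Icc (-1 : ℝ) 1, j ≠ k ∧ f j x = f k x ∧ c j + w j * x < c k + w k * x ∧
        p = (c j + w j * x, c k + w k * x) := by
  constructor
  · rintro ⟨hp, hA⟩
    have hA1 : p.1 ∈ strandSet c w := not_not.1 hA
    obtain ⟨k, y, hy, e2⟩ := (hd.mem_iff hp).1 hA1
    obtain ⟨j, x, hx, e1⟩ := hA1
    have e := hp.2.2.2
    rw [e1, e2, h.apply_eq_iff hx hy] at e
    obtain ⟨rfl, e⟩ := e
    have hlt := hp.2.1
    rw [e1, e2] at hlt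
    exact ⟨j, k, x, hx, fun hjk => by simp [hjk] at hlt, e, hlt, Prod.ext e1 e2⟩
  · rintro ⟨j, k, x, hx, hjk, e, hlt, rfl⟩
    have m1 : c j + w j * x ∈ strandSet c w := ⟨j, x, hx, rfl⟩
    have m2 : c k + w k * x ∈ strandSet c w := ⟨k, x, hx, rfl⟩
    exact ⟨⟨(hd.agree.1 m1).1.le, hlt, (hd.agree.1 m2).2, (h.apply_eq_iff hx hx).2 ⟨rfl, e⟩⟩,
      not_not.2 m1⟩

/-- Transversality of the generic curve, translated into slopes by `Strands.det2_velocity`. -/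
theorem Strands.slope_ne (h : Strands ψ c w f C) (hd : DiscMove ψ (strandSet c w) C C')
    {j k : Fin n} (hjk : j ≠ k) {x : ℝ} (hx : x ∈ Ioo (-1 : ℝ) 1) (he : f j x = f k x) :
    deriv (f j) x ≠ deriv (f k) x := by
  have hx' := Ioo_subset_Icc_self hx
  have aux : ∀ j k, j ≠ k → f j x = f k x → c j + w j * x < c k + w k * x →
      deriv (f j) x ≠ deriv (f k) x := by
    intro j k hjk he hlt e
    have hp := ((h.mem_crossings_iff hd).2 ⟨j, k, x, hx', hjk, he, hlt, rfl⟩).1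
    have h1 := h.det2_velocity j k hx he
    rw [e, sub_self, mul_zero] at h1
    exact mul_ne_zero (C.det2_velocity_ne_zero hp)
      (mul_ne_zero (h.param.ne_zero j) (h.param.ne_zero k)) h1
  rcases lt_or_gt_of_ne (h.param.disjoint j k hjk x hx' x hx') with hlt | hlt
  · exact aux j k hjk he hlt
  · exact (aux k j hjk.symm he.symm hlt).symm

/-- The ends of the loops slide along the strands from abscissa `x` to `y` without leaving the
chart. With `C' = C` this compares the two crossings of a bigon. -/
theorem Strands.arcClass_eq (h : Strands ψ c w f C) (h' : Strands ψ c w g C')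
    (hp : Parallel ψ C C') {j k : Fin n} {x y : ℝ} (hx : x ∈ Icc (-1 : ℝ) 1) (hy : y ∈ Icc (-1 : ℝ) 1)
    (hf : f j x = f k x) (hg : g j y = g k y) :
    C.arcClass (c j + w j * x) (c k + w k * x) = C'.arcClass (c j + w j * y) (c k + w k * y) ∧
    C.arcClass (c k + w k * x) (c j + w j * x + 1) =
      C'.arcClass (c k + w k * y) (c j + w j * y + 1) := by
  have hseg : ∀ (k : Fin n), ∀ u ∈ Icc (0 : ℝ) 1,
      C.toFun (c k + w k * x + u * (c k + w k * y - (c k + w k * x))) ∈ range ψ ∧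
      C'.toFun (c k + w k * x + u * (c k + w k * y - (c k + w k * x))) ∈ range ψ := by
    intro k u hu
    have e : c k + w k * x + u * (c k + w k * y - (c k + w k * x)) =
        c k + w k * (x + u * (y - x)) := by ring
    rw [e]
    have hm := segment_mem (convex_Icc (-1 : ℝ) 1) hx hy hu
    exact ⟨h.mem_range k hm, h'.mem_range k hm⟩
  have hseg1 : ∀ u ∈ Icc (0 : ℝ) 1,
      C.toFun (c j + w j * x + 1 + u * (c j + w j * y + 1 - (c j + w j * x + 1))) ∈ range ψ ∧
      C'.toFun (c j + w j * x + 1 + u * (c j + w j * y + 1 - (c j + w j * x + 1))) ∈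
        range ψ := by
    intro u hu
    have e : c j + w j * x + 1 + u * (c j + w j * y + 1 - (c j + w j * x + 1)) =
        c j + w j * x + u * (c j + w j * y - (c j + w j * x)) + 1 := by ring
    rw [e, C.periodic, C'.periodic]
    exact hseg j u hu
  have e := (h.apply_eq_iff hx hx).2 ⟨rfl, hf⟩
  have e' := (h'.apply_eq_iff hy hy).2 ⟨rfl, hg⟩
  exact ⟨arcClass_eq_of_moving h.emb hp (hseg j) (hseg k) e e',
    arcClass_eq_of_moving h.emb hp (hseg k) hseg1 (by rw [C.periodic, e])
      (by rw [C'.periodic, e'])⟩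

variable [IsManifold (𝓡∂ 2) ∞ S]

theorem Strands.plane_pos (h : Strands ψ c w f C) (o : OrientationAlong C.toFun) (k : Fin n)
    {x y : ℝ} (hx : x ∈ Icc (-1 : ℝ) 1) (hy : y ∈ Icc (-1 : ℝ) 1) :
    0 < (o.val (c k + w k * x) * planeJac ψ (C.toFun (c k + w k * x))) *
      (o.val (c k + w k * y) * planeJac ψ (C.toFun (c k + w k * y))) := by
  refine o.plane_pos h.emb (J := (fun x => c k + w k * x) '' Icc (-1 : ℝ) 1)
    (isPreconnected_Icc.image _ (by fun_prop)) ?_ ⟨x, hx, rfl⟩ ⟨y, hy, rfl⟩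
  rintro _ ⟨z, hz, rfl⟩
  exact h.mem_range k hz

/-- The orientations of `C` and `C'` agree along each strand. -/
def StrandCompat (ψ : ℝ × ℝ → S) (c w : Fin n → ℝ) (o : OrientationAlong C.toFun)
    (o' : OrientationAlong C'.toFun) : Prop :=
  ∀ k, ∀ x ∈ Icc (-1 : ℝ) 1, ∀ y ∈ Icc (-1 : ℝ) 1,
    0 < (o.val (c k + w k * x) * planeJac ψ (C.toFun (c k + w k * x))) *
      (o'.val (c k + w k * y) * planeJac ψ (C'.toFun (c k + w k * y)))

theorem Strands.strandCompat (h : Strands ψ c w f C) (h' : Strands ψ c w g C')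
    {o : OrientationAlong C.toFun} {o' : OrientationAlong C'.toFun} (hoo : o.Compat ψ o') :
    StrandCompat ψ c w o o' := by
  intro k x hx y hy
  have h1 := h.plane_pos o k hx hy
  have h2 := hoo.1 (c k + w k * y) (h.mem_range k hy) (h'.mem_range k hy)
  have h3 := mul_pos h1 h2
  refine pos_of_mul_pos_right (a := (o.val (c k + w k * y) *
    planeJac ψ (C.toFun (c k + w k * y))) ^ 2) ?_ (sq_nonneg _)
  linarith

/-! ### Comparing the signs of two crossings of the same strands. -/

section TwoCrossings

variable {o : OrientationAlong C.toFun} {o' : OrientationAlong C'.toFun} {j k : Fin n} {x y : ℝ}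

/-- At a crossing both strands see the same planar Jacobian, so the Jacobians enter squared. -/
theorem Strands.relative_orientation (h : Strands ψ c w f C) (h' : Strands ψ c w g C')
    (hoo : StrandCompat ψ c w o o') (hx : x ∈ Icc (-1 : ℝ) 1) (hy : y ∈ Icc (-1 : ℝ) 1)
    (hf : f j x = f k x) (hg : g j y = g k y) :
    0 < o.val (c j + w j * x) * o.val (c k + w k * x) *
      (o'.val (c j + w j * y) * o'.val (c k + w k * y)) := by
  have h1 := mul_pos (hoo j x hx y hy) (hoo k x hx y hy)
  rw [(h.apply_eq_iff hx hx).2 ⟨rfl, hf⟩, (h'.apply_eq_iff hy hy).2 ⟨rfl, hg⟩] at h1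
  refine pos_of_mul_pos_right (a := (planeJac ψ (C.toFun (c k + w k * x)) *
    planeJac ψ (C'.toFun (c k + w k * y))) ^ 2) ?_ (sq_nonneg _)
  linarith

/-- The directions `w` of the strands are common to both crossings and cancel in sign; the
comparison is decided by the differences of slopes. -/
theorem Strands.relative_position (h : Strands ψ c w f C) (h' : Strands ψ c w g C')
    (hoo : StrandCompat ψ c w o o') (hx : x ∈ Ioo (-1 : ℝ) 1) (hy : y ∈ Ioo (-1 : ℝ) 1)
    (hf : f j x = f k x) (hg : g j y = g k y) :
    ∃ d : ℝ, 0 < d ∧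
      (o.val (c j + w j * x) *
        det2 (velocity C.toFun (c j + w j * x)) (velocity C.toFun (c k + w k * x))) *
      (o'.val (c j + w j * y) *
        det2 (velocity C'.toFun (c j + w j * y)) (velocity C'.toFun (c k + w k * y))) =
      d * ((deriv (f k) x - deriv (f j) x) * (deriv (g k) y - deriv (g j) y)) := by
  have e1 := h.det2_velocity j k hx hf
  have e2 := h'.det2_velocity j k hy hg
  have hw : 0 < (w j * w k) ^ 2 :=
    sq_pos_of_ne_zero (mul_ne_zero (h.param.ne_zero j) (h.param.ne_zero k))
  refine ⟨_, div_pos (hoo j x (Ioo_subset_Icc_self hx) y (Ioo_subset_Icc_self hy)) hw, ?_⟩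
  rw [div_mul_eq_mul_div, eq_div_iff hw.ne']
  generalize det2 (velocity C.toFun (c j + w j * x)) (velocity C.toFun (c k + w k * x)) = A at *
  generalize det2 (velocity C'.toFun (c j + w j * y)) (velocity C'.toFun (c k + w k * y)) = B at *
  calc _ = o.val (c j + w j * x) * o'.val (c j + w j * y) *
        ((A * (w j * w k)) * (B * (w j * w k))) := by ring
    _ = _ := by rw [e1, e2]; ring

end TwoCrossings

end Strands

/-! ## The second and the third move -/

/-- The sum is `1 + 1` or `i + (-i)`. This is where the coefficients have to be reduced modulo `2`.
-/
theorem flatCoeff_add_mem {N : AddSubgroup GaussianInt} (hN : 2 ∈ N) {γ : ℝ → S} {o : ℝ → ℝ}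
    {s t s' t' : ℝ} (h1 : 0 < o s * o t * (o s' * o t'))
    (h2 : (o s * det2 (velocity γ s) (velocity γ t)) *
      (o s' * det2 (velocity γ s') (velocity γ t')) < 0) :
    flatCoeff γ o s t + flatCoeff γ o s' t' ∈ N := by
  unfold flatCoeff
  generalize o s * o t = a at *
  generalize o s' * o t' = b at *
  generalize o s * det2 (velocity γ s) (velocity γ t) = c at *
  generalize o s' * det2 (velocity γ s') (velocity γ t') = d at *
  have e1 : 0 < a ↔ 0 < b := ⟨fun h => pos_of_mul_pos_right h1 h.le,
    fun h => pos_of_mul_pos_left h1 h.le⟩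
  have i1 : (1 : GaussianInt) + 1 = 2 := by decide
  have i2 : (⟨0, 1⟩ : GaussianInt) + ⟨0, -1⟩ = 0 := by decide
  have i3 : (⟨0, -1⟩ : GaussianInt) + ⟨0, 1⟩ = 0 := by decide
  rcases mul_neg_iff.1 h2 with ⟨e2, e3⟩ | ⟨e2, e3⟩ <;> by_cases hb : 0 < b <;>
    simp [e1, hb, e2, e3, e2.not_gt, e3.not_gt, i1, i2, i3, hN, N.zero_mem]

/-- Passing from below to above gives the weak inequality of slopes; transversality makes it strict.
-/
theorem CrossesUpAt.data {n : ℕ} {ψ : ℝ × ℝ → S} {c w : Fin n → ℝ} {f : Fin n → ℝ → ℝ}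
    {C C' : GenericCurve S} (h : Strands ψ c w f C) (hd : DiscMove ψ (strandSet c w) C C')
    {j k : Fin n} (hjk : j ≠ k) {z : ℝ} (hz : CrossesUpAt (f j) (f k) z) :
    f j z = f k z ∧ (∀ x ∈ Icc (-1 : ℝ) 1, f j x = f k x → x = z) ∧
      deriv (f k) z < deriv (f j) z := by
  obtain ⟨hm, hl, hr⟩ := hz
  have hdiff : ∀ k, HasDerivAt (f k) (deriv (f k) z) z := fun k => by
    obtain ⟨_, -, hz, -⟩ := h.hasDerivAt k hm
    exact hz.differentiableAt.hasDerivAt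
  have evl : ∀ᶠ x in 𝓝[<] z, f j x < f k x := by
    filter_upwards [Ioo_mem_nhdsLT hm.1] with x hx using hl x ⟨hx.1.le, hx.2⟩
  have evr : ∀ᶠ x in 𝓝[>] z, f k x < f j x := by
    filter_upwards [Ioo_mem_nhdsGT hm.2] with x hx using hr x ⟨hx.1, hx.2.le⟩
  obtain ⟨e, hle⟩ := eq_and_deriv_le_of_crossing (hdiff j) (hdiff k) evl evr
  refine ⟨e, fun x hx ex => ?_, lt_of_le_of_ne hle (h.slope_ne hd hjk hm e).symm⟩
  rcases lt_trichotomy x z with h1 | h1 | h1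
  · exact absurd ex (hl x ⟨hx.1, h1⟩).ne
  · exact h1
  · exact absurd ex (hr x ⟨h1, hx.2⟩).ne'

variable [IsManifold (𝓡∂ 2) ∞ S]

/-- At the two corners of the bigon the slope difference has opposite signs, while loop classes and
relative orientation agree; the two terms cancel modulo `N`. -/
theorem MoveR2.deltaCorrespond {C C' : GenericCurve S} (h : MoveR2 C C')
    {N : AddSubgroup GaussianInt} (hN : 2 ∈ N) : DeltaCorrespond N C C' := by
  obtain ⟨f, g, hfg, hg, x₁, x₂, hx₁, hx₁₂, hx₂, hl, hm, hr⟩ := h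
  obtain ⟨ψ, c, w, hC, hC', hd⟩ := hfg.data
  have m₁ : x₁ ∈ Ioo (-1 : ℝ) 1 := ⟨hx₁, hx₁₂.trans hx₂⟩
  have m₂ : x₂ ∈ Ioo (-1 : ℝ) 1 := ⟨hx₁.trans hx₁₂, hx₂⟩
  have n₁ := Ioo_subset_Icc_self m₁
  have n₂ := Ioo_subset_Icc_self m₂
  have hdiff : ∀ k, ∀ x ∈ Ioo (-1 : ℝ) 1, HasDerivAt (f k) (deriv (f k) x) x := fun k x hx => by
    obtain ⟨_, -, hz, -⟩ := hC.hasDerivAt k hx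
    exact hz.differentiableAt.hasDerivAt
  have evm : ∀ᶠ x in 𝓝[>] x₁, f 1 x < f 0 x := by
    filter_upwards [Ioo_mem_nhdsGT hx₁₂] with x hx using hm x hx
  have evm' : ∀ᶠ x in 𝓝[<] x₂, f 1 x < f 0 x := by
    filter_upwards [Ioo_mem_nhdsLT hx₁₂] with x hx using hm x hx
  have evl : ∀ᶠ x in 𝓝[<] x₁, f 0 x < f 1 x := by
    filter_upwards [Ioo_mem_nhdsLT hx₁] with x hx using hl x ⟨hx.1.le, hx.2⟩
  have evr : ∀ᶠ x in 𝓝[>] x₂, f 0 x < f 1 x := by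
    filter_upwards [Ioo_mem_nhdsGT hx₂] with x hx using hr x ⟨hx.1, hx.2.le⟩
  obtain ⟨e₁, d₁⟩ := eq_and_deriv_le_of_crossing (hdiff 0 _ m₁) (hdiff 1 _ m₁) evl evm
  obtain ⟨e₂, d₂⟩ := eq_and_deriv_le_of_crossing (hdiff 1 _ m₂) (hdiff 0 _ m₂) evm' evr
  have s₁ := lt_of_le_of_ne d₁ (hC.slope_ne hd (j := 0) (k := 1) (by decide) m₁ e₁).symm
  have s₂ := lt_of_le_of_ne d₂ (hC.slope_ne hd (j := 0) (k := 1) (by decide) m₂ e₂.symm)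
  have huniq : ∀ x ∈ Icc (-1 : ℝ) 1, f 0 x = f 1 x → x = x₁ ∨ x = x₂ := by
    intro x hx e
    rcases lt_trichotomy x x₁ with h1 | h1 | h1
    · exact absurd e (hl x ⟨hx.1, h1⟩).ne
    · exact Or.inl h1
    · rcases lt_trichotomy x x₂ with h2 | h2 | h2
      · exact absurd e (hm x ⟨h1, h2⟩).ne'
      · exact Or.inr h2
      · exact absurd e (hr x ⟨h2, hx.2⟩).ne
  refine hd.deltaCorrespond N fun o o' _ => ?_
  have h0 : ∑ᶠ p ∈ crossings C'.toFun \ {p | p.1 ∉ strandSet c w}, C'.term N o'.val p = 0 := by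
    refine finsum_mem_of_eqOn_zero fun p hp => ?_
    obtain ⟨j, k, x, hx, hjk, e, -, -⟩ := (hC'.mem_crossings_iff hd.symm).1 hp
    have := hg x hx
    fin_cases j <;> fin_cases k <;> first | exact absurd rfl hjk | (simp at e; linarith)
  rw [h0]
  -- Stated for `j` the strand traversed first, which may be either of the two.
  have main : ∀ j k : Fin 2, j ≠ k → (∀ x ∈ Icc (-1 : ℝ) 1, f j x = f k x → x = x₁ ∨ x = x₂) →
      f j x₁ = f k x₁ → f j x₂ = f k x₂ →
      (deriv (f k) x₁ - deriv (f j) x₁) * (deriv (f k) x₂ - deriv (f j) x₂) < 0 →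
      c j + w j * x₁ < c k + w k * x₁ →
      ∑ᶠ p ∈ crossings C.toFun \ {p | p.1 ∉ strandSet c w}, C.term N o.val p = 0 := by
    intro j k hjk huniq e₁ e₂ hs hlt
    have hset : crossings C.toFun \ {p | p.1 ∉ strandSet c w} =
        {(c j + w j * x₁, c k + w k * x₁), (c j + w j * x₂, c k + w k * x₂)} := by
      ext p
      rw [hC.mem_crossings_iff hd]
      constructor
      · rintro ⟨j', k', x, hx, hjk', e, hlt', rfl⟩
        have hj : j' = j ∧ k' = k := by
          by_cases hj : j' = j
          · refine ⟨hj, ?_⟩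
            subst hj
            revert hjk hjk'
            clear * -
            revert j' k k'
            decide
          · have h3 : j' = k ∧ k' = j := by
              revert hjk hjk' hj
              clear * -
              revert j' j k k'
              decide
            obtain ⟨rfl, rfl⟩ := h3
            exact absurd (hC.param.lt hjk' hx hx n₁ n₁ hlt') hlt.not_gt
        obtain ⟨rfl, rfl⟩ := hj
        rcases huniq x hx e with rfl | rfl
        · exact Or.inl rfl
        · exact Or.inr rfl
      · rintro (rfl | rfl)
        · exact ⟨j, k, x₁, n₁, hjk, e₁, hlt, rfl⟩
        · exact ⟨j, k, x₂, n₂, hjk, e₂, hC.param.lt hjk n₁ n₁ n₂ n₂ hlt, rfl⟩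
    rw [hset, finsum_mem_pair]
    · have hoo : StrandCompat ψ c w o o := fun k x hx y hy => hC.plane_pos o k hx hy
      obtain ⟨a1, a2⟩ := hC.arcClass_eq hC (Parallel.refl ψ C) n₁ n₂ e₁ e₂
      have r1 := hC.relative_orientation hC hoo n₁ n₂ e₁ e₂
      obtain ⟨d, hd0, r2⟩ := hC.relative_position hC hoo m₁ m₂ e₁ e₂
      unfold GenericCurve.term
      simp only [a1, a2]
      rw [monomial_add]
      exact monomial_of_mem N (flatCoeff_add_mem hN r1
        (by rw [r2]; exact mul_neg_of_pos_of_neg hd0 hs)) _ _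
    · intro e
      exact hx₁₂.ne (hC.param.inj n₁ n₂ (Prod.ext_iff.1 e).1).2
  rcases lt_or_gt_of_ne (hC.param.disjoint 0 1 (by decide) x₁ n₁ x₁ n₁) with hlt | hlt
  · exact main 0 1 (by decide) huniq e₁ e₂.symm
      (mul_neg_of_neg_of_pos (by linarith) (by linarith)) hlt
  · exact main 1 0 (by decide) (fun x hx e => huniq x hx e.symm) e₁.symm e₂
      (mul_neg_of_pos_of_neg (by linarith) (by linarith)) hlt

/-- The graphs of `u`, `v` and those of `u'`, `v'` cross exactly once, in the same direction. -/
def SameCrossing (u v u' v' : ℝ → ℝ) : Prop :=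
  ∃ x ∈ Ioo (-1 : ℝ) 1, ∃ y ∈ Ioo (-1 : ℝ) 1, u x = v x ∧ u' y = v' y ∧
    (∀ z ∈ Icc (-1 : ℝ) 1, u z = v z → z = x) ∧ (∀ z ∈ Icc (-1 : ℝ) 1, u' z = v' z → z = y) ∧
    0 < (deriv v x - deriv u x) * (deriv v' y - deriv u' y)

theorem SameCrossing.symm {u v u' v' : ℝ → ℝ} (h : SameCrossing u v u' v') :
    SameCrossing v u v' u' := by
  obtain ⟨x, hx, y, hy, e, e', hu, hu', hs⟩ := h
  exact ⟨x, hx, y, hy, e.symm, e'.symm, fun z hz ez => hu z hz ez.symm,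
    fun z hz ez => hu' z hz ez.symm, by linarith⟩

/-- The crossing of two strands in `C` is matched with that of the same strands in `C'`; equal
direction of crossing gives equal coefficients, and sliding along the strands gives equal loop
classes. -/
theorem Strands.deltaCorrespond {n : ℕ} {ψ : ℝ × ℝ → S} {c w : Fin n → ℝ} {f g : Fin n → ℝ → ℝ}
    {C C' : GenericCurve S} (hC : Strands ψ c w f C) (hC' : Strands ψ c w g C')
    (hd : DiscMove ψ (strandSet c w) C C')
    (hs : ∀ j k, j ≠ k → SameCrossing (f j) (f k) (g j) (g k)) (N : AddSubgroup GaussianInt) :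
    DeltaCorrespond N C C' := by
  refine hd.deltaCorrespond N fun o o' hoo => ?_
  have hsc := hC.strandCompat hC' hoo
  refine finsum_mem_eq_of_rel (fun p p' => ∃ j k, ∃ x ∈ Ioo (-1 : ℝ) 1, ∃ y ∈ Ioo (-1 : ℝ) 1,
    j ≠ k ∧ f j x = f k x ∧ g j y = g k y ∧ p = (c j + w j * x, c k + w k * x) ∧
    p' = (c j + w j * y, c k + w k * y)) ?_ ?_ ?_ ?_ ?_
  · intro p hp
    obtain ⟨j, k, x, hx, hjk, e, hlt, rfl⟩ := (hC.mem_crossings_iff hd).1 hp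
    obtain ⟨x', hx', y, hy, ex, ey, hux, -, -⟩ := hs j k hjk
    obtain rfl := hux x hx e
    have hy' := Ioo_subset_Icc_self hy
    exact ⟨_, (hC'.mem_crossings_iff hd.symm).2 ⟨j, k, y, hy', hjk, ey,
      hC.param.lt hjk hx hx hy' hy' hlt, rfl⟩, j, k, x, hx', y, hy, hjk, e, ey, rfl, rfl⟩
  · intro p hp
    obtain ⟨j, k, y, hy, hjk, e, hlt, rfl⟩ := (hC'.mem_crossings_iff hd.symm).1 hp
    obtain ⟨x, hx, y', hy', ex, ey, -, huy, -⟩ := hs j k hjk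
    obtain rfl := huy y hy e
    have hx' := Ioo_subset_Icc_self hx
    exact ⟨_, (hC.mem_crossings_iff hd).2 ⟨j, k, x, hx', hjk, ex,
      hC.param.lt hjk hy hy hx' hx' hlt, rfl⟩, j, k, x, hx, y, hy', hjk, ex, e, rfl, rfl⟩
  · rintro p - q - q' - ⟨j, k, x, hx, y, hy, hjk, ex, ey, rfl, rfl⟩
      ⟨j', k', x', hx', y', hy', -, ex', ey', h, rfl⟩
    obtain ⟨rfl, -⟩ := hC.param.inj (Ioo_subset_Icc_self hx) (Ioo_subset_Icc_self hx')
      (Prod.ext_iff.1 h).1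
    obtain ⟨rfl, -⟩ := hC.param.inj (Ioo_subset_Icc_self hx) (Ioo_subset_Icc_self hx')
      (Prod.ext_iff.1 h).2
    obtain ⟨_, -, _, -, -, -, -, huy, -⟩ := hs j k hjk
    rw [huy y (Ioo_subset_Icc_self hy) ey, huy y' (Ioo_subset_Icc_self hy') ey']
  · rintro q - p - p' - ⟨j, k, x, hx, y, hy, hjk, ex, ey, rfl, rfl⟩
      ⟨j', k', x', hx', y', hy', -, ex', ey', rfl, h⟩
    obtain ⟨rfl, -⟩ := hC.param.inj (Ioo_subset_Icc_self hy) (Ioo_subset_Icc_self hy')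
      (Prod.ext_iff.1 h).1
    obtain ⟨rfl, -⟩ := hC.param.inj (Ioo_subset_Icc_self hy) (Ioo_subset_Icc_self hy')
      (Prod.ext_iff.1 h).2
    obtain ⟨_, -, _, -, -, -, hux, -, -⟩ := hs j k hjk
    rw [hux x (Ioo_subset_Icc_self hx) ex, hux x' (Ioo_subset_Icc_self hx') ex']
  · rintro p - q - ⟨j, k, x, hx, y, hy, hjk, ex, ey, rfl, rfl⟩
    have mx := Ioo_subset_Icc_self hx
    have my := Ioo_subset_Icc_self hy
    obtain ⟨a1, a2⟩ := hC.arcClass_eq hC' hd.parallel mx my ex ey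
    unfold GenericCurve.term
    simp only [a1, a2]
    congr 1
    obtain ⟨d, hd0, r⟩ := hC.relative_position hC' hsc hx hy ex ey
    refine flatCoeff_congr (hC.relative_orientation hC' hsc mx my ex ey) ?_
    rw [r]
    obtain ⟨x', -, y', -, -, -, hux, huy, hpos⟩ := hs j k hjk
    obtain rfl := hux x mx ex
    obtain rfl := huy y my ey
    exact mul_pos hd0 hpos

theorem MoveR3.deltaCorrespond {C C' : GenericCurve S} (h : MoveR3 C C')
    (N : AddSubgroup GaussianInt) : DeltaCorrespond N C C' := by
  obtain ⟨f, g, hfg, ⟨_, _, _, -, -, f01, f02, f12⟩, ⟨_, _, _, -, -, g01, g02, g12⟩⟩ := h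
  obtain ⟨ψ, c, w, hC, hC', hd⟩ := hfg.data
  have key : ∀ j k : Fin 3, j ≠ k → ∀ x y, CrossesUpAt (f j) (f k) x →
      CrossesUpAt (g j) (g k) y → SameCrossing (f j) (f k) (g j) (g k) := by
    intro j k hjk x y hx hy
    obtain ⟨e1, e2, e3⟩ := hx.data hC hd hjk
    obtain ⟨e4, e5, e6⟩ := hy.data hC' hd.symm hjk
    exact ⟨x, hx.1, y, hy.1, e1, e4, e2, e5, mul_pos_of_neg_of_neg (by linarith) (by linarith)⟩
  have s01 := key 0 1 (by decide) _ _ f01 g01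
  have s02 := key 0 2 (by decide) _ _ f02 g02
  have s12 := key 1 2 (by decide) _ _ f12 g12
  refine hC.deltaCorrespond hC' hd (fun j k hjk => ?_) N
  fin_cases j <;> fin_cases k <;> first
    | exact absurd rfl hjk
    | exact s01 | exact s02 | exact s12 | exact s01.symm | exact s02.symm | exact s12.symm

/-! ## Invariance -/

theorem FlatEquivalent.deltaCorrespond [T2Space S] {C C' : GenericCurve S}
    (h : FlatEquivalent C C') {N : AddSubgroup GaussianInt} (hN : 2 ∈ N) :
    DeltaCorrespond N C C' := by
  induction h with
  | rel C C' h =>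
    rcases h with h | h | h | h
    · exact h.deltaCorrespond N
    · exact h.deltaCorrespond N
    · exact h.deltaCorrespond hN
    · exact h.deltaCorrespond N
  | refl C => exact ⟨fun o => ⟨o, rfl⟩, fun o => ⟨o, rfl⟩⟩
  | symm C C' _ ih =>
    refine ⟨fun o => ?_, fun o => ?_⟩
    · obtain ⟨o', h⟩ := ih.2 o
      exact ⟨o', h.symm⟩
    · obtain ⟨o', h⟩ := ih.1 o
      exact ⟨o', h.symm⟩
  | trans C C' C'' _ _ ih ih' =>
    refine ⟨fun o => ?_, fun o => ?_⟩
    · obtain ⟨o', h⟩ := ih.1 o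
      obtain ⟨o'', h'⟩ := ih'.1 o'
      exact ⟨o'', h.trans h'⟩
    · obtain ⟨o', h⟩ := ih'.2 o
      obtain ⟨o'', h'⟩ := ih.2 o'
      exact ⟨o'', h'.trans h⟩

/-- The invariant of labeled diagrams with coefficients modulo a subgroup containing `2` does not
change under flat moves, up to conjugation. -/
theorem Diagram.deltaBar_eqUpToConj [T2Space S] {D₁ D₂ : Diagram S}
    (h : FlatEquivalent D₁.toGenericCurve D₂.toGenericCurve) {N : AddSubgroup GaussianInt}
    (hN : N ≤ N.comap conjR) (h2 : 2 ∈ N) (L₁ : Labeling D₁.toGenericCurve)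
    (L₂ : Labeling D₂.toGenericCurve) :
    EqUpToConj N hN (D₁.deltaBar N L₁) (D₂.deltaBar N L₂) := by
  rw [D₁.deltaBar_eq, D₂.deltaBar_eq]
  -- The transported orientation need not be the one of `L₂`; this is the source of the conjugation.
  obtain ⟨o', ho'⟩ := (h.deltaCorrespond h2).1 L₁.orientation
  rw [ho']
  exact D₂.delta_conj N hN o' L₂.orientation

end

end FlatTuraev

end

theorem mainTheorem2 {S : Type*} [TopologicalSpace S] [T2Space S]
    [ChartedSpace (EuclideanHalfSpace 2) S] [IsManifold (𝓡∂ 2) ∞ S]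
    (D₁ D₂ : FlatTuraev.Diagram S)
    (h₁ : D₁.PseudoClassical) (h₂ : D₂.PseudoClassical)
    (h : FlatTuraev.FlatEquivalent D₁.toGenericCurve D₂.toGenericCurve) :
    Nonempty (FlatTuraev.Labeling D₁.toGenericCurve) ∧
    Nonempty (FlatTuraev.Labeling D₂.toGenericCurve) ∧
    ∀ (L₁ : FlatTuraev.Labeling D₁.toGenericCurve) (L₂ : FlatTuraev.Labeling D₂.toGenericCurve),
      FlatTuraev.EqUpToConj FlatTuraev.R₂ FlatTuraev.R₂_conj
        (D₁.deltaBar FlatTuraev.R₂ L₁) (D₂.deltaBar FlatTuraev.R₂ L₂) ∧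
      FlatTuraev.EqUpToConj FlatTuraev.twoZ FlatTuraev.twoZ_conj
        (D₁.deltaBar FlatTuraev.twoZ L₁) (D₂.deltaBar FlatTuraev.twoZ L₂) := by
  refine ⟨h₁.nonempty_labeling, h₂.nonempty_labeling, fun L₁ L₂ => ⟨?_, ?_⟩⟩
  · exact FlatTuraev.Diagram.deltaBar_eqUpToConj h _ (by change Even (2 : ℤ); decide) L₁ L₂
  · exact FlatTuraev.Diagram.deltaBar_eqUpToConj h _
      (by change Even (2 : ℤ) ∧ (0 : ℤ) = 0; decide) L₁ L₂
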